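/- Let $(X,\mathcal A)$ be a topological space with a sheaf $\mathcal A$ of unital, commutative, associative $K$-algebras, $K=\mathbb R$ or $\mathbb C$, let $\Omega$ be an $\mathcal A$-module and $d:\mathcal A\to\Omega$ a $K$-linear morphism with $d(ab)=a\,db+b\,da$. Let $\mathcal G$ be a sheaf of groups of Lie type: there are given an $\mathcal A$-module of Lie algebras $\mathcal L$, a representation $\varrho:\mathcal G\to\mathcal{A}ut(\mathcal L)$ (by automorphisms of $\mathcal A$-modules of Lie algebras) and a morphism of sheaves of sets $\partial:\mathcal G\to\Omega\otimes_{\mathcal A}\mathcal L$ with $\partial(st)=\varrho(t^{-1}).\partial(s)+\partial(t)$, where $\varrho(g).(\theta\otimes u)=\theta\otimes\varrho(g)(u)$. Let $\mathcal P$ be a principal sheaf with structure sheaf $\mathcal G$: a sheaf of sets with a right $\mathcal G$-action, an open covering $(U_\alpha)$ of $X$ and $\mathcal G$-equivariant isomorphisms $\phi_\alpha:\mathcal P|_{U_\alpha}\to\mathcal G|_{U_\alpha}$. Its natural sections are $s_\alpha=\phi_\alpha^{-1}(1)$, and its cocycle $(g_{\alpha\beta})$ is defined by $s_\beta=s_\alpha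 g_{\alpha\beta}$ over $U_{\alpha\beta}=U_\alpha\cap U_\beta$. Let $\varphi:\mathcal G\to\mathcal{GL}(n,\mathcal A)$ be a morphism of sheaves of groups. The sheaf $\mathcal E$ associated with $\mathcal P$ by $\varphi$ is the sheaf generated by the presheaf $U\mapsto(\mathcal P(U)\times\mathcal A(U)^n)/\mathcal G(U)$, where $(s,a)\sim(sg,\varphi(g^{-1})a)$, with the $\mathcal A$-module structure for which the maps $a\mapsto[s,a]$ are $\mathcal A$-linear. For a section $s$ of $\mathcal P$ over $U$ let $\psi_s:\mathcal A(U)^n\to\mathcal E(U)$, $a\mapsto[s,a]$; write $\psi_\alpha=\psi_{s_\alpha}$ (and also for its restrictions to smaller open sets), and $e^\alpha_j=\psi_\alpha(0,\dots,1,\dots,0)$ with the $1$ at the place $j$. On $\mathcal{GL}(n,\mathcal A)$ put $\widetilde\partial(a)=a^{-1}\,da$, a section of $\Omega\otimes_{\mathcal A}M_n(\mathcal A)$, whose sections are identified with matrices of sections of $\Omega$ through $(\theta_{ij})\mapsto\sum_{i,j}\theta_{ij}\otimes E_{ij}$, with $E_{ij}$ the matrix units; and $\mathcal Ad(g)(x)=gxg^{-1}$.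 Suppose that $\varphi$ is of Lie type: there is a morphism $\overline\varphi:\mathcal L\to M_n(\mathcal A)$ of sheaves of Lie algebras over $\mathcal A$ with $$\widetilde\partial\circ\varphi=(1\otimes\overline\varphi)\circ\partial,\qquad \overline\varphi\circ\varrho(g)=\mathcal Ad(\varphi(g))\circ\overline\varphi\quad\text{for all sections } g \text{ of }\mathcal G,$$ and fix such a $\overline\varphi$. Let $D$ be a connection on $\mathcal P$, that is, a morphism of sheaves of sets $D:\mathcal P\to\Omega\otimes_{\mathcal A}\mathcal L$ with $D(sg)=\varrho(g^{-1}).D(s)+\partial(g)$, and put $\omega_\alpha=D(s_\alpha)$ and $\theta_\alpha=(1\otimes\overline\varphi)(\omega_\alpha)\in(\Omega\otimes_{\mathcal A}M_n(\mathcal A))(U_\alpha)$. Then $\mathcal E$ is a vector sheaf of rank $n$ (locally isomorphic to $\mathcal A^n$ as an $\mathcal A$-module), with the cocycle $\psi_\alpha^{-1}\circ\psi_\beta=\varphi(g_{\alpha\beta})$; for all $\alpha,\beta$, $$\theta_\beta=\mathcal Ad(\varphi(g_{\alpha\beta})^{-1}).\theta_\alpha+\widetilde\partial(\varphi(g_{\alpha\beta}))\quad\text{over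 }U_{\alpha\beta};$$ and there is exactly one $\mathcal A$-connection $\nabla$ on $\mathcal E$ with local connection forms $\theta_\alpha$, that is, exactly one $K$-linear morphism of sheaves $\nabla:\mathcal E\to\mathcal E\otimes_{\mathcal A}\Omega$ with $\nabla(as)=a\nabla(s)+s\otimes da$ such that for every $\alpha$ the matrix $(\theta^\alpha_{ij})$ of $\theta_\alpha$ satisfies $\nabla(e^\alpha_j)=\sum_{i}e^\alpha_i\otimes\theta^\alpha_{ij}$ for all $j$. -/

import Mathlib

open CategoryTheory TopologicalSpace Opposite MonoidalCategory TensorProduct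

universe u v w

noncomputable section

namespace ADG

variable {X : TopCat.{u}}

/-- Sections over `U` of a sheaf of commutative rings. -/
abbrev Sec (A : X.Sheaf CommRingCat.{u}) (U : Opens X) : Type u := A.obj.obj (op U)

/-- Restriction of sections of a sheaf of commutative rings. -/
abbrev rres (A : X.Sheaf CommRingCat.{u}) {U V : Opens X} (h : V ≤ U) : Sec A U →+* Sec A V :=
  (A.obj.map (homOfLE h).op).hom

/-- The sheaf of (not necessarily commutative) rings underlying a sheaf of commutative rings. -/
abbrev ringSheaf (A : X.Sheaf CommRingCat.{u}) : X.Sheaf RingCat.{u} :=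
  (sheafCompose (Opens.grothendieckTopology X) (forget₂ CommRingCat.{u} RingCat.{u})).obj A

/-- Presheaves of `A`-modules. -/
abbrev PMod (A : X.Sheaf CommRingCat.{u}) :=
  PresheafOfModules.{u} (A.obj ⋙ forget₂ CommRingCat.{u} RingCat.{u})

/-- Sheaves of `A`-modules. -/
abbrev SMod (A : X.Sheaf CommRingCat.{u}) := SheafOfModules.{u} (ringSheaf A)

section Modules

variable {A : X.Sheaf CommRingCat.{u}}

/-- Sections over `U` of a presheaf of `A`-modules. -/
abbrev PMod.Γ (M : PMod A) (U : Opens X) : Type u := M.obj (op U)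

/-- The presheaf of `A`-modules underlying a sheaf of `A`-modules. -/
abbrev SMod.pre (M : SMod A) : PMod A := M.val

/-- Restriction of sections of a presheaf of `A`-modules. -/
def PMod.res (M : PMod A) {U V : Opens X} (h : V ≤ U) : M.Γ U →+ M.Γ V :=
  (M.presheaf.map (homOfLE h).op).hom


/-- The presheaf of `A`-modules `U ↦ M(U) ⊗_{A(U)} N(U)`. -/
abbrev tensorPre (M N : PMod A) : PMod A := M ⊗ N

/-- The sheaf of `A`-modules `M ⊗_A N`, generated by the presheaf `U ↦ M(U) ⊗_{A(U)} N(U)`. -/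
def tensorSheaf (M N : PMod A) : SMod A :=
  (PresheafOfModules.sheafification (R := ringSheaf A) (𝟙 (ringSheaf A).obj)).obj (tensorPre M N)

/-- The canonical map of the presheaf `U ↦ M(U) ⊗ N(U)` into the sheaf `M ⊗_A N`. -/
def toTensorSheaf (M N : PMod A) :
    (tensorPre M N).presheaf ⟶ (tensorSheaf M N).pre.presheaf :=
  toSheafify (Opens.grothendieckTopology X) (tensorPre M N).presheaf

/-- The section `m ⊗ n` of `M ⊗_A N` defined by sections `m` of `M` and `n` of `N`. -/
def tmul (M N : PMod A) {U : Opens X} (m : M.Γ U) (n : N.Γ U) : (tensorSheaf M N).pre.Γ U :=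
  (toTensorSheaf M N).app (op U) (m ⊗ₜ[Sec A U] n : (M.Γ U) ⊗[Sec A U] (N.Γ U))

/-- The map induced on sections by the morphism `1 ⊗ f : M ⊗_A N ⟶ M ⊗_A N'`. -/
def tensorMap (M : PMod A) {N N' : PMod A} (f : N ⟶ N') (U : Opens X) :
    (tensorSheaf M N).pre.Γ U →+ (tensorSheaf M N').pre.Γ U :=
  ((((PresheafOfModules.sheafification (R := ringSheaf A) (𝟙 (ringSheaf A).obj)).map
    (M ◁ f)).val.app (op U)).hom).toAddMonoidHom

end Modules

/-- A presheaf of `A`-modules of Lie algebras: each `L(U)` is a Lie algebra over `A(U)`, and the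
restriction maps are additive, semilinear and compatible with the brackets. -/
structure LiePresheaf (A : X.Sheaf CommRingCat.{u}) where
  obj : Opens X → Type u
  [lieRing : ∀ U, LieRing (obj U)]
  [lieAlgebra : ∀ U, LieAlgebra (Sec A U) (obj U)]
  res : ∀ {U V : Opens X}, V ≤ U → obj U →+ obj V
  res_self : ∀ {U : Opens X} (x : obj U), res le_rfl x = x
  res_res : ∀ {U V W : Opens X} (h : V ≤ U) (k : W ≤ V) (x : obj U),
    res k (res h x) = res (k.trans h) x
  res_smul : ∀ {U V : Opens X} (h : V ≤ U) (a : Sec A U) (x : obj U),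
    res h (a • x) = rres A h a • res h x
  res_lie : ∀ {U V : Opens X} (h : V ≤ U) (x y : obj U), res h ⁅x, y⁆ = ⁅res h x, res h y⁆

attribute [instance] LiePresheaf.lieRing LiePresheaf.lieAlgebra

namespace LiePresheaf

variable {A : X.Sheaf CommRingCat.{u}} (L : LiePresheaf A)

/-- The underlying presheaf of abelian groups. -/
def ab : (Opens X)ᵒᵖ ⥤ AddCommGrpCat.{u} where
  obj U := AddCommGrpCat.of (L.obj U.unop)
  map f := AddCommGrpCat.ofHom (L.res (leOfHom f.unop))
  map_id U := by ext x; exact L.res_self x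
  map_comp f g := by ext x; exact (L.res_res _ _ x).symm

instance (U : (Opens X)ᵒᵖ) : Module ((A.obj ⋙ forget₂ CommRingCat.{u} RingCat.{u}).obj U)
    (L.ab.obj U) :=
  inferInstanceAs (Module (Sec A U.unop) (L.obj U.unop))

/-- The underlying presheaf of `A`-modules. -/
def pre : PMod A := PresheafOfModules.ofPresheaf L.ab
  (fun _ _ f a x => L.res_smul (leOfHom f.unop) a x)

/-- Morphisms of presheaves of `A`-modules of Lie algebras. -/
structure Hom (L M : LiePresheaf A) where
  app : ∀ U, L.obj U →ₗ⁅Sec A U⁆ M.obj U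
  app_res : ∀ {U V : Opens X} (h : V ≤ U) (x : L.obj U),
    app V (L.res h x) = M.res h (app U x)

/-- The underlying morphism of presheaves of `A`-modules. -/
def Hom.pre {L M : LiePresheaf A} (f : Hom L M) : L.pre ⟶ M.pre :=
  PresheafOfModules.homMk (M₁ := L.pre) (M₂ := M.pre)
    { app := fun U => AddCommGrpCat.ofHom (f.app U.unop : L.obj U.unop →ₗ[Sec A U.unop] M.obj U.unop).toAddMonoidHom
      naturality := fun U V g => by
        ext x; exact f.app_res (leOfHom g.unop) x }
    (fun U a x => (f.app U.unop).map_smul a x)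

end LiePresheaf

/-- `M_n(A)`: the complete presheaf `U ↦ M_n(A(U))` with the commutator bracket. -/
def matLie (n : ℕ) (A : X.Sheaf CommRingCat.{u}) : LiePresheaf A where
  obj U := Matrix (Fin n) (Fin n) (Sec A U)
  lieRing _ := LieRing.ofAssociativeRing
  lieAlgebra _ := LieAlgebra.ofAssociativeAlgebra
  res h := (rres A h).mapMatrix.toAddMonoidHom
  res_self x := by
    ext i j
    have : A.obj.map (𝟙 (op _)) (x i j) = x i j := by simp
    exact this
  res_res h k x := by
    ext i j
    have := ConcreteCategory.congr_hom (A.obj.map_comp (homOfLE h).op (homOfLE k).op) (x i j)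
    exact this.symm
  res_smul h a x := by
    ext i j
    simp
  res_lie h x y := by
    change (x * y - y * x).map (rres A h) = x.map (rres A h) * y.map (rres A h) -
      y.map (rres A h) * x.map (rres A h)
    rw [← Matrix.map_mul, ← Matrix.map_mul]
    ext i j
    simp [-Matrix.map_mul]

/-- `GL(n, A)`: the complete presheaf of groups `U ↦ GL(n, A(U))`. -/
def glPre (n : ℕ) (A : X.Sheaf CommRingCat.{u}) : (Opens X)ᵒᵖ ⥤ GrpCat.{u} where
  obj U := GrpCat.of (GL (Fin n) (A.obj.obj U))
  map f := GrpCat.ofHom (Matrix.GeneralLinearGroup.map (A.obj.map f).hom)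
  map_id U := by ext g; simp
  map_comp f g := by ext g; simp

/-- A representation `ρ : G ⟶ Aut(L)` of a presheaf of groups in a presheaf of Lie algebras. As
`Aut(L)(U)` is the group of automorphisms of `L` restricted to `U`, such a morphism is the same as
a family of actions of the groups `G(U)` on `L(U)` by automorphisms of Lie algebras over `A(U)`,
compatible with restrictions. -/
structure LieRep {A : X.Sheaf CommRingCat.{u}} (G : (Opens X)ᵒᵖ ⥤ GrpCat.{u})
    (L : LiePresheaf A) where
  app : ∀ U : Opens X, G.obj (op U) → (L.obj U ≃ₗ⁅Sec A U⁆ L.obj U)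
  app_one : ∀ U x, app U 1 x = x
  app_mul : ∀ U (g h : G.obj (op U)) x, app U (g * h) x = app U g (app U h x)
  app_res : ∀ {U V : Opens X} (h : V ≤ U) (g : G.obj (op U)) (x : L.obj U),
    L.res h (app U g x) = app V (G.map (homOfLE h).op g) (L.res h x)



section Conj

attribute [local instance] LieRing.ofAssociativeRing

variable {n : ℕ} {R S : Type*} [CommRing R] [CommRing S]

/-- Conjugation `x ↦ g x g⁻¹`, as an automorphism of the Lie algebra of matrices. -/
def glConj (g : GL (Fin n) R) : Matrix (Fin n) (Fin n) R ≃ₗ⁅R⁆ Matrix (Fin n) (Fin n) R :=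
  Matrix.lieConj g.1 g.invertible

lemma glConj_apply (g : GL (Fin n) R) (x : Matrix (Fin n) (Fin n) R) :
    glConj g x = g.1 * x * (g⁻¹).1 := by
  rw [Matrix.coe_units_inv]; exact Matrix.lieConj_apply _ _ _

lemma glConj_one (x : Matrix (Fin n) (Fin n) R) : glConj 1 x = x := by
  simp [glConj_apply]

lemma glConj_mul (g h : GL (Fin n) R) (x : Matrix (Fin n) (Fin n) R) :
    glConj (g * h) x = glConj g (glConj h x) := by
  simp only [glConj_apply, mul_inv_rev, Units.val_mul, mul_assoc]

lemma glConj_map (f : R →+* S) (g : GL (Fin n) R) (x : Matrix (Fin n) (Fin n) R) :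
    (glConj g x).map f = glConj (Matrix.GeneralLinearGroup.map f g) (x.map f) := by
  rw [glConj_apply, glConj_apply, Matrix.map_mul, Matrix.map_mul, ← map_inv]
  rfl

end Conj

/-- The adjoint representation of `GL(n, A)` in `M_n(A)`, `Ad(g)(x) = g x g⁻¹`. -/
def Ad (n : ℕ) (A : X.Sheaf CommRingCat.{u}) : LieRep (glPre n A) (matLie n A) where
  app U g := glConj (R := Sec A U) g
  app_one U x := glConj_one (R := Sec A U) x
  app_mul U g h x := glConj_mul (R := Sec A U) g h x
  app_res h g x := glConj_map (rres A h) g x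

section Extend

/-- The presheaf `V ↦ F(U ∩ V)`. -/
def locPre (U : Opens X) (F : (Opens X)ᵒᵖ ⥤ AddCommGrpCat.{u}) : (Opens X)ᵒᵖ ⥤ AddCommGrpCat.{u} :=
  (Opens.map U.inclusion').op ⋙ U.isOpenEmbedding.isOpenMap.functor.op ⋙ F

lemma locPre_isSheaf (U : Opens X) (F : X.Sheaf AddCommGrpCat.{u}) :
    Presheaf.IsSheaf (Opens.grothendieckTopology X) (locPre U F.obj) :=
  TopCat.Sheaf.pushforward_sheaf_of_sheaf U.inclusion'
    (TopCat.Presheaf.isSheaf_of_isOpenEmbedding (F := F.obj) U.isOpenEmbedding F.property)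


/-- Let `F` be a sheaf and `f` a family of maps `T(V) → F(V)`, `V ⊆ U`, compatible with
restrictions. This is the value on `U` of its unique extension to the sheaf generated by `T`. -/
def extendLocally {T : (Opens X)ᵒᵖ ⥤ AddCommGrpCat.{u}} (F : X.Sheaf AddCommGrpCat.{u})
    (U : Opens X) (f : ∀ V : Opens X, V ≤ U → (T.obj (op V) →+ F.obj.obj (op V)))
    (hf : ∀ {V W : Opens X} (h : V ≤ U) (k : W ≤ V) (t : T.obj (op V)),
      f W (k.trans h) (T.map (homOfLE k).op t) = F.obj.map (homOfLE k).op (f V h t)) :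
    (sheafify (Opens.grothendieckTopology X) T).obj (op U) →+ F.obj.obj (op U) :=
  let W (V : Opens X) : Opens X :=
    U.isOpenEmbedding.isOpenMap.functor.obj ((Opens.map U.inclusion').obj V)
  have hU (V : Opens X) : W V ≤ U := by
    rintro _ ⟨y, _, rfl⟩; exact y.2
  have hV (V : Opens X) : W V ≤ V := by
    rintro _ ⟨y, hy, rfl⟩; exact hy
  have hW : U ≤ W U := fun x hx => ⟨⟨x, hx⟩, hx, rfl⟩
  let φ : T ⟶ locPre U F.obj :=
    { app := fun V => AddCommGrpCat.ofHom
        ((f (W V.unop) (hU V.unop)).comp (T.map (homOfLE (hV V.unop)).op).hom)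
      naturality := fun V V' g => by
        ext t
        have hg : W V'.unop ≤ W V.unop := Set.image_mono fun y hy => leOfHom g.unop hy
        have h1 := hf (hU V.unop) hg (T.map (homOfLE (hV V.unop)).op t)
        rw [← ConcreteCategory.comp_apply, ← T.map_comp] at h1
        change f _ _ (T.map (homOfLE (hV V'.unop)).op (T.map g t)) = F.obj.map _ (f _ _ _)
        rw [← ConcreteCategory.comp_apply, ← T.map_comp]
        exact h1 }
  (F.obj.map (homOfLE hW).op).hom.comp
    ((sheafifyLift (Opens.grothendieckTopology X) φ (locPre_isSheaf U F)).app (op U)).hom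

lemma extendLocally_toSheafify {T : (Opens X)ᵒᵖ ⥤ AddCommGrpCat.{u}} (F : X.Sheaf AddCommGrpCat.{u})
    (U : Opens X) (f : ∀ V : Opens X, V ≤ U → (T.obj (op V) →+ F.obj.obj (op V)))
    (hf : ∀ {V W : Opens X} (h : V ≤ U) (k : W ≤ V) (t : T.obj (op V)),
      f W (k.trans h) (T.map (homOfLE k).op t) = F.obj.map (homOfLE k).op (f V h t))
    (t : T.obj (op U)) :
    extendLocally F U f hf ((toSheafify (Opens.grothendieckTopology X) T).app (op U) t) =
      f U le_rfl t := by
  unfold extendLocally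
  extract_lets W hU hV hW φ
  have h1 : (sheafifyLift (Opens.grothendieckTopology X) φ (locPre_isSheaf U F)).app (op U)
      ((toSheafify (Opens.grothendieckTopology X) T).app (op U) t) = φ.app (op U) t := by
    rw [← ConcreteCategory.comp_apply, ← NatTrans.comp_app, toSheafify_sheafifyLift]
  change F.obj.map (homOfLE hW).op _ = _
  erw [h1]
  change F.obj.map (homOfLE hW).op (f (W U) _ (T.map (homOfLE (hV U)).op t)) = _
  rw [← hf (hU U) hW, ← ConcreteCategory.comp_apply, ← T.map_comp]
  have : (homOfLE (hV U)).op ≫ (homOfLE hW).op = 𝟙 (op U) := rfl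
  rw [this, T.map_id]; rfl

end Extend

section Action

lemma tensor_addHom_ext {R M N P : Type*} [CommRing R] [AddCommGroup M] [AddCommGroup N]
    [AddCommGroup P] [Module R M] [Module R N] {f g : M ⊗[R] N →+ P}
    (h : ∀ m n, f (m ⊗ₜ[R] n) = g (m ⊗ₜ[R] n)) : f = g := by
  ext t
  induction t using TensorProduct.induction_on with
  | zero => simp
  | add x y hx hy => rw [map_add, map_add, hx, hy]
  | tmul m n => exact h m n

variable {A : X.Sheaf CommRingCat.{u}} {G : (Opens X)ᵒᵖ ⥤ GrpCat.{u}} {L : LiePresheaf A}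

/-- `1 ⊗ ρ(g)` on `M(U) ⊗ L(U)`. -/
def LieRep.preAct (ρ : LieRep G L) (M : PMod A) {U : Opens X} (g : G.obj (op U)) :
    (M.Γ U) ⊗[Sec A U] (L.obj U) →ₗ[Sec A U] (M.Γ U) ⊗[Sec A U] (L.obj U) :=
  LinearMap.lTensor (M.Γ U) ((ρ.app U g).toLinearMap : L.obj U →ₗ[Sec A U] L.obj U)

lemma LieRep.preAct_res (ρ : LieRep G L) (M : PMod A) {U V : Opens X} (h : V ≤ U)
    (g : G.obj (op U)) (t : (M.Γ U) ⊗[Sec A U] (L.obj U)) :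
    ρ.preAct M (G.map (homOfLE h).op g) ((tensorPre M L.pre).presheaf.map (homOfLE h).op t) =
      (tensorPre M L.pre).presheaf.map (homOfLE h).op (ρ.preAct M g t) := by
  let r : (M.Γ U) ⊗[Sec A U] (L.obj U) →+ (M.Γ V) ⊗[Sec A V] (L.obj V) :=
    ((tensorPre M L.pre).presheaf.map (homOfLE h).op).hom
  have key : (ρ.preAct M (G.map (homOfLE h).op g)).toAddMonoidHom.comp r =
      r.comp (ρ.preAct M g).toAddMonoidHom := by
    refine tensor_addHom_ext fun m l => ?_
    change M.res h m ⊗ₜ[Sec A V] (ρ.app V (G.map (homOfLE h).op g) (L.res h l)) =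
      M.res h m ⊗ₜ[Sec A V] (L.res h (ρ.app U g l))
    rw [ρ.app_res h g l]
  exact DFunLike.congr_fun key t

/-- The composites `M(V) ⊗ L(V) → M(V) ⊗ L(V) → (M ⊗_A L)(V)` of `1 ⊗ ρ(g|_V)` and the canonical
map, for `V ⊆ U` and `g` in `G(U)`. -/
def LieRep.actFam (ρ : LieRep G L) (M : PMod A) {U : Opens X} (g : G.obj (op U))
    (V : Opens X) (h : V ≤ U) :
    (tensorPre M L.pre).presheaf.obj (op V) →+ (tensorSheaf M L.pre).pre.Γ V :=
  ((toTensorSheaf M L.pre).app (op V)).hom.comp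
    (ρ.preAct M (G.map (homOfLE h).op g)).toAddMonoidHom

lemma LieRep.actFam_res (ρ : LieRep G L) (M : PMod A) {U : Opens X} (g : G.obj (op U))
    {V W : Opens X} (h : V ≤ U) (k : W ≤ V) (t : (tensorPre M L.pre).presheaf.obj (op V)) :
    ρ.actFam M g W (k.trans h) ((tensorPre M L.pre).presheaf.map (homOfLE k).op t) =
      (tensorSheaf M L.pre).pre.presheaf.map (homOfLE k).op (ρ.actFam M g V h t) := by
  have h1 := ConcreteCategory.congr_hom ((toTensorSheaf M L.pre).naturality (homOfLE k).op)
    (ρ.preAct M (G.map (homOfLE h).op g) t)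
  refine Eq.trans ?_ h1
  have h2 := ρ.preAct_res M k (G.map (homOfLE h).op g) t
  rw [← ConcreteCategory.comp_apply, ← G.map_comp] at h2
  exact congrArg ((toTensorSheaf M L.pre).app (op W)) h2

/-- The action of `g ∈ G(U)` on `(M ⊗_A L)(U)` induced by `ρ`: it is determined by
`m ⊗ l ↦ m ⊗ ρ(g)(l)` on the sections over the open subsets of `U`. -/
def LieRep.tensorAct (ρ : LieRep G L) (M : PMod A) {U : Opens X} (g : G.obj (op U)) :
    (tensorSheaf M L.pre).pre.Γ U →+ (tensorSheaf M L.pre).pre.Γ U :=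
  extendLocally (T := (tensorPre M L.pre).presheaf)
    ((SheafOfModules.toSheaf _).obj (tensorSheaf M L.pre)) U (ρ.actFam M g) (ρ.actFam_res M g)

lemma LieRep.tensorAct_tmul (ρ : LieRep G L) (M : PMod A) {U : Opens X} (g : G.obj (op U))
    (m : M.Γ U) (l : L.obj U) :
    ρ.tensorAct M g (tmul M L.pre m l) = tmul M L.pre m (ρ.app U g l) := by
  have hg : G.map (homOfLE (le_refl U)).op g = g :=
    ConcreteCategory.congr_hom (G.map_id (op U)) g
  refine (extendLocally_toSheafify
    ((SheafOfModules.toSheaf _).obj (tensorSheaf M L.pre)) U (ρ.actFam M g)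
    (ρ.actFam_res M g) _).trans ?_
  change (toTensorSheaf M L.pre).app (op U)
    (m ⊗ₜ[Sec A U] (ρ.app U (G.map (homOfLE (le_refl U)).op g) l)) = _
  rw [hg]
  rfl

end Action


section Principal

/-- A principal sheaf with structure sheaf `G`: a sheaf of sets `P` with a right action of `G`, an
open covering and `G`-equivariant isomorphisms of `P` with `G` over its members (`G` acts on itself
by right translations). -/
structure PrincipalSheaf (G : X.Sheaf GrpCat.{u}) where
  P : X.Sheaf (Type u)
  act : ∀ {U : Opens X}, P.obj.obj (op U) → G.obj.obj (op U) → P.obj.obj (op U)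
  act_one : ∀ {U : Opens X} (s : P.obj.obj (op U)), act s 1 = s
  act_mul : ∀ {U : Opens X} (s : P.obj.obj (op U)) (g h : G.obj.obj (op U)),
    act s (g * h) = act (act s g) h
  act_res : ∀ {U V : Opens X} (h : V ≤ U) (s : P.obj.obj (op U)) (g : G.obj.obj (op U)),
    P.obj.map (homOfLE h).op (act s g) =
      act (P.obj.map (homOfLE h).op s) (G.obj.map (homOfLE h).op g)
  ι : Type v
  cover : ι → Opens X
  iSup_cover : ⨆ α, cover α = ⊤
  triv : ∀ (α : ι) {V : Opens X}, V ≤ cover α → P.obj.obj (op V) ≃ G.obj.obj (op V)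
  triv_act : ∀ (α : ι) {V : Opens X} (h : V ≤ cover α) (s : P.obj.obj (op V))
    (g : G.obj.obj (op V)), triv α h (act s g) = triv α h s * g
  triv_res : ∀ (α : ι) {V W : Opens X} (h : V ≤ cover α) (k : W ≤ V) (s : P.obj.obj (op V)),
    triv α (k.trans h) (P.obj.map (homOfLE k).op s) = G.obj.map (homOfLE k).op (triv α h s)

namespace PrincipalSheaf

variable {G : X.Sheaf GrpCat.{u}} (P : PrincipalSheaf.{u, v} G)

/-- Sections of `P` over `U`. -/
abbrev Γ (U : Opens X) : Type u := P.P.obj.obj (op U)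

/-- Restriction of sections of `P`. -/
abbrev res {U V : Opens X} (h : V ≤ U) (s : P.Γ U) : P.Γ V := P.P.obj.map (homOfLE h).op s

/-- Restriction of sections of a sheaf of groups. -/
abbrev _root_.ADG.gres (G : X.Sheaf GrpCat.{u}) {U V : Opens X} (h : V ≤ U) :
    G.obj.obj (op U) →* G.obj.obj (op V) := (G.obj.map (homOfLE h).op).hom

lemma res_res {U V W : Opens X} (h : V ≤ U) (k : W ≤ V) (s : P.Γ U) :
    P.res k (P.res h s) = P.res (k.trans h) s := by
  have := ConcreteCategory.congr_hom (P.P.obj.map_comp (homOfLE h).op (homOfLE k).op) s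
  exact this.symm

lemma res_self {U : Opens X} (s : P.Γ U) : P.res le_rfl s = s :=
  ConcreteCategory.congr_hom (P.P.obj.map_id (op U)) s

lemma le_iSup_inf (U : Opens X) : U ≤ ⨆ α, U ⊓ P.cover α := by
  rw [← inf_iSup_eq, P.iSup_cover, inf_top_eq]

/-- The natural section `s_α` over `U_α`, which corresponds to the unit section of `G`. -/
def natSec (α : P.ι) : P.Γ (P.cover α) := (P.triv α le_rfl).symm 1

/-- The cocycle `g_αβ` of `P`, determined by `s_β = s_α g_αβ` over `U_α ∩ U_β`. -/
def cocycle (α β : P.ι) : G.obj.obj (op (P.cover α ⊓ P.cover β)) :=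
  P.triv α inf_le_left (P.res inf_le_right (P.natSec β))

lemma act_eq_iff (α : P.ι) {V : Opens X} (h : V ≤ P.cover α) (s t : P.Γ V)
    (g : G.obj.obj (op V)) : t = P.act s g ↔ g = (P.triv α h s)⁻¹ * P.triv α h t := by
  rw [← (P.triv α h).apply_eq_iff_eq, P.triv_act, eq_inv_mul_iff_mul_eq, eq_comm]

lemma natSec_cocycle (α β : P.ι) :
    P.res inf_le_right (P.natSec β) = P.act (P.res inf_le_left (P.natSec α)) (P.cocycle α β) := by
  rw [P.act_eq_iff α inf_le_left, P.triv_res α le_rfl inf_le_left]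
  simp [natSec, cocycle]

lemma existsUnique_act {U : Opens X} (s t : P.Γ U) : ∃! g : G.obj.obj (op U), t = P.act s g := by
  have huniq : ∀ {V : Opens X} (s t : P.Γ V) (g g' : G.obj.obj (op V)),
      t = P.act s g → t = P.act s g' → g = g' := by
    intro V s t g g' hg hg'
    refine G.eq_of_locally_eq' (fun α => V ⊓ P.cover α) V (fun α => homOfLE inf_le_left)
      (P.le_iSup_inf V) g g' fun α => ?_
    have h1 := P.act_res (inf_le_left : V ⊓ P.cover α ≤ V) s g
    have h2 := P.act_res (inf_le_left : V ⊓ P.cover α ≤ V) s g'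
    rw [← hg] at h1
    rw [← hg'] at h2
    exact ((P.act_eq_iff α inf_le_right _ _ _).1 h1).trans
      ((P.act_eq_iff α inf_le_right _ _ _).1 h2).symm
  obtain ⟨g, hg, -⟩ := G.existsUnique_gluing' (fun α => U ⊓ P.cover α) U
    (fun α => homOfLE inf_le_left) (P.le_iSup_inf U)
    (fun α => (P.triv α inf_le_right (P.res inf_le_left s))⁻¹ *
      P.triv α inf_le_right (P.res inf_le_left t)) (by
        intro α β
        have loc : ∀ (γ : P.ι) (W : Opens X) (k : W ≤ U ⊓ P.cover γ),
            P.res (k.trans inf_le_left) t = P.act (P.res (k.trans inf_le_left) s)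
              (G.obj.map (homOfLE k).op ((P.triv γ inf_le_right (P.res inf_le_left s))⁻¹ *
                P.triv γ inf_le_right (P.res inf_le_left t))) := by
          intro γ W k
          have h1 := congrArg (P.res k) ((P.act_eq_iff γ inf_le_right (P.res inf_le_left s)
            (P.res inf_le_left t) _).2 rfl)
          rw [P.res_res] at h1
          refine h1.trans ((P.act_res k _ _).trans ?_)
          congr 1
          exact P.res_res _ _ _
        exact huniq _ _ _ _ (loc α _ inf_le_left) (loc β _ inf_le_right))
  refine ⟨g, ?_, fun g' hg' => huniq s t g' g hg' ?_⟩ <;>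
  · refine P.P.eq_of_locally_eq' (fun α => U ⊓ P.cover α) U (fun α => homOfLE inf_le_left)
      (P.le_iSup_inf U) _ _ fun α => ?_
    refine Eq.trans ?_ (P.act_res (inf_le_left : U ⊓ P.cover α ≤ U) s g).symm
    exact (P.act_eq_iff α inf_le_right _ _ _).2 (hg α)

end PrincipalSheaf

end Principal

section Associated

variable {A : X.Sheaf CommRingCat.{u}} {n : ℕ} {G : X.Sheaf GrpCat.{u}}

/-- Restriction of sections of `A^n`. -/
def vres (A : X.Sheaf CommRingCat.{u}) {n : ℕ} {U V : Opens X} (h : V ≤ U)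
    (a : Fin n → Sec A U) : Fin n → Sec A V := fun i => rres A h (a i)

/-- The action of `GL(n, A)` on `A^n`. -/
abbrev glVec {U : Opens X} (g : (glPre n A).obj (op U)) (a : Fin n → Sec A U) :
    Fin n → Sec A U := (g : GL (Fin n) (Sec A U)).1.mulVec a

lemma glVec_one {U : Opens X} (a : Fin n → Sec A U) :
    glVec (1 : (glPre n A).obj (op U)) a = a := Matrix.one_mulVec a

lemma glVec_mul {U : Opens X} (g h : (glPre n A).obj (op U)) (a : Fin n → Sec A U) :
    glVec (g * h) a = glVec g (glVec h a) := by
  exact (Matrix.mulVec_mulVec a _ _).symm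

lemma vres_glVec {U V : Opens X} (h : V ≤ U) (g : (glPre n A).obj (op U))
    (a : Fin n → Sec A U) :
    vres A h (glVec g a) = glVec ((glPre n A).map (homOfLE h).op g) (vres A h a) := by
  ext i
  exact (RingHom.map_mulVec (rres A h) (g : GL (Fin n) (Sec A U)).1 a i)

lemma vres_self {U : Opens X} (a : Fin n → Sec A U) : vres A le_rfl a = a := by
  ext i
  exact ConcreteCategory.congr_hom (A.obj.map_id (op U)) (a i)

lemma vres_vres {U V W : Opens X} (h : V ≤ U) (k : W ≤ V) (a : Fin n → Sec A U) :
    vres A k (vres A h a) = vres A (k.trans h) a := by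
  ext i
  exact (ConcreteCategory.congr_hom (A.obj.map_comp (homOfLE h).op (homOfLE k).op) (a i)).symm

namespace PrincipalSheaf

variable (P : PrincipalSheaf.{u, v} G) (φ : G.obj ⟶ glPre n A)

lemma app_gres {U V : Opens X} (h : V ≤ U) (g : G.obj.obj (op U)) :
    φ.app (op V) (gres G h g) = (glPre n A).map (homOfLE h).op (φ.app (op U) g) :=
  ConcreteCategory.congr_hom (φ.naturality (homOfLE h).op) g

/-- `(s, a) ∼ (t, b)` if and only if there is a unique `g` with `t = s g` and `b = φ(g⁻¹) a`. -/
def assocSetoid (U : Opens X) : Setoid (P.Γ U × (Fin n → Sec A U)) where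
  r x y := ∃! g : G.obj.obj (op U),
    y.1 = P.act x.1 g ∧ y.2 = glVec (φ.app (op U) g⁻¹) x.2
  iseqv := by
    have key : ∀ x y : P.Γ U × (Fin n → Sec A U),
        (∃ g : G.obj.obj (op U), y.1 = P.act x.1 g ∧ y.2 = glVec (φ.app (op U) g⁻¹) x.2) →
        ∃! g : G.obj.obj (op U), y.1 = P.act x.1 g ∧ y.2 = glVec (φ.app (op U) g⁻¹) x.2 := by
      rintro x y ⟨g, hg⟩
      exact ⟨g, hg, fun g' hg' => (P.existsUnique_act x.1 y.1).unique hg'.1 hg.1⟩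
    refine ⟨fun x => key _ _ ⟨1, ?_, ?_⟩, fun {x y} h => ?_, fun {x y z} h k => ?_⟩
    · rw [P.act_one]
    · rw [inv_one, map_one, glVec_one]
    · obtain ⟨g, ⟨h1, h2⟩, -⟩ := h
      refine key _ _ ⟨g⁻¹, ?_, ?_⟩
      · rw [h1, ← P.act_mul, mul_inv_cancel, P.act_one]
      · rw [h2, ← glVec_mul, ← map_mul, inv_inv, mul_inv_cancel, map_one, glVec_one]
    · obtain ⟨g, ⟨h1, h2⟩, -⟩ := h
      obtain ⟨g', ⟨h1', h2'⟩, -⟩ := k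
      refine key _ _ ⟨g * g', ?_, ?_⟩
      · rw [h1', h1, P.act_mul]
      · rw [h2', h2, ← glVec_mul, ← map_mul, mul_inv_rev]

/-- The presheaf of sets `Q(U) = (P(U) × A(U)^n) / G(U)`. -/
def assocPre : (Opens X)ᵒᵖ ⥤ Type u where
  obj U := Quotient (P.assocSetoid φ U.unop)
  map {U V} f := ↾(Quotient.map (fun x => (P.res (leOfHom f.unop) x.1, vres A (leOfHom f.unop) x.2)) (by
    rintro x y ⟨g, ⟨h1, h2⟩, -⟩
    have h3 : P.res (leOfHom f.unop) y.1 =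
        P.act (P.res (leOfHom f.unop) x.1) (gres G (leOfHom f.unop) g) := by
      rw [h1]; exact P.act_res _ _ _
    refine ⟨gres G (leOfHom f.unop) g, ⟨h3, ?_⟩, fun g' hg' =>
      (P.existsUnique_act _ _).unique hg'.1 h3⟩
    rw [h2, vres_glVec, ← map_inv, app_gres]))
  map_id U := by
    ext x
    induction x using Quotient.inductionOn with
    | h x =>
      exact congrArg (Quotient.mk (P.assocSetoid φ U.unop))
        (Prod.ext (P.res_self x.1) (vres_self x.2))
  map_comp {U V W} f g := by
    ext x
    induction x using Quotient.inductionOn with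
    | h x =>
      exact congrArg (Quotient.mk (P.assocSetoid φ W.unop))
        (Prod.ext (P.res_res _ _ x.1).symm (vres_vres _ _ x.2).symm)

/-- The associated sheaf, as a sheaf of sets: the sheaf generated by `Q`. -/
def assocSet : X.Sheaf (Type u) := (presheafToSheaf (Opens.grothendieckTopology X) (Type u)).obj (P.assocPre φ)

/-- Sections of the associated sheaf. -/
abbrev AssocSec (U : Opens X) : Type u := (P.assocSet φ).obj.obj (op U)

/-- The canonical map of the presheaf `Q` into the sheaf that it generates. -/
def toAssoc : P.assocPre φ ⟶ (P.assocSet φ).obj := toSheafify (Opens.grothendieckTopology X) _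

instance : Presheaf.IsLocallyInjective (Opens.grothendieckTopology X) (P.toAssoc φ) :=
  inferInstanceAs (Presheaf.IsLocallyInjective _ (toSheafify _ _))

instance : Presheaf.IsLocallySurjective (Opens.grothendieckTopology X) (P.toAssoc φ) :=
  inferInstanceAs (Presheaf.IsLocallySurjective _ (toSheafify _ _))

/-- The section `[s, a]` of the associated sheaf. -/
def cls {U : Opens X} (s : P.Γ U) (a : Fin n → Sec A U) : P.AssocSec φ U :=
  (P.toAssoc φ).app (op U) (Quotient.mk (P.assocSetoid φ U) (s, a))

/-- Restriction of sections of the associated sheaf. -/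
abbrev assocRes {U V : Opens X} (h : V ≤ U) (σ : P.AssocSec φ U) : P.AssocSec φ V :=
  (P.assocSet φ).obj.map (homOfLE h).op σ

lemma assocRes_self {U : Opens X} (σ : P.AssocSec φ U) : P.assocRes φ le_rfl σ = σ :=
  ConcreteCategory.congr_hom ((P.assocSet φ).obj.map_id (op U)) σ

lemma assocRes_assocRes {U V W : Opens X} (h : V ≤ U) (k : W ≤ V) (σ : P.AssocSec φ U) :
    P.assocRes φ k (P.assocRes φ h σ) = P.assocRes φ (k.trans h) σ :=
  (ConcreteCategory.congr_hom
    ((P.assocSet φ).obj.map_comp (homOfLE h).op (homOfLE k).op) σ).symm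

lemma cls_res {U V : Opens X} (h : V ≤ U) (s : P.Γ U) (a : Fin n → Sec A U) :
    P.assocRes φ h (P.cls φ s a) = P.cls φ (P.res h s) (vres A h a) :=
  (ConcreteCategory.congr_hom ((P.toAssoc φ).naturality (homOfLE h).op)
    (Quotient.mk (P.assocSetoid φ U) (s, a))).symm

lemma cls_act {U : Opens X} (s : P.Γ U) (g : G.obj.obj (op U)) (a : Fin n → Sec A U) :
    P.cls φ (P.act s g) a = P.cls φ s (glVec (φ.app (op U) g) a) := by
  refine congrArg ((P.toAssoc φ).app (op U)) (Quotient.sound (s := P.assocSetoid φ U) ?_)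
  refine (P.assocSetoid φ U).iseqv.symm (x := (s, glVec (φ.app (op U) g) a)) ⟨g, ⟨rfl, ?_⟩,
    fun g' hg' => (P.existsUnique_act _ _).unique hg'.1 rfl⟩
  rw [← glVec_mul, ← map_mul, inv_mul_cancel, map_one, glVec_one]

lemma cls_injective {U : Opens X} (s : P.Γ U) : Function.Injective (P.cls φ s) := by
  intro a b hab
  have hS := Presheaf.equalizerSieve_mem (Opens.grothendieckTopology X) (P.toAssoc φ)
    (X := op U) (Quotient.mk (P.assocSetoid φ U) (s, a))
    (Quotient.mk (P.assocSetoid φ U) (s, b)) hab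
  choose V f hV hx using hS
  ext i
  refine A.eq_of_locally_eq' (fun x : U => V x.1 x.2) U (fun x => f x.1 x.2)
    (fun x hx' => Opens.mem_iSup.2 ⟨⟨x, hx'⟩, hx x hx'⟩) _ _ fun x => ?_
  obtain ⟨g, ⟨h1, h2⟩, -⟩ := Quotient.exact (s := P.assocSetoid φ (V x.1 x.2)) (hV x.1 x.2)
  have hg : g = 1 := (P.existsUnique_act _ _).unique h1 (P.act_one _).symm
  rw [hg, inv_one, map_one, glVec_one] at h2
  exact (congrFun h2 i).symm

lemma cls_surjective {U : Opens X} (s : P.Γ U) : Function.Surjective (P.cls φ s) := by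
  intro σ
  have hS := Presheaf.imageSieve_mem (Opens.grothendieckTopology X) (P.toAssoc φ) (U := op U) σ
  choose V f hV hx using hS
  have hloc : ∀ x : U, ∃ a : Fin n → Sec A (V x.1 x.2),
      P.cls φ (P.res (leOfHom (f x.1 x.2)) s) a = P.assocRes φ (leOfHom (f x.1 x.2)) σ := by
    intro x
    obtain ⟨q, hq⟩ := hV x.1 x.2
    obtain ⟨⟨t, b⟩, rfl⟩ := Quotient.exists_rep q
    obtain ⟨g, hg, -⟩ := P.existsUnique_act (P.res (leOfHom (f x.1 x.2)) s) t
    refine ⟨glVec (φ.app _ g) b, ?_⟩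
    rw [← cls_act, ← hg]
    exact hq
  choose a ha using hloc
  have hcov : U ≤ ⨆ x : U, V x.1 x.2 :=
    fun x hx' => Opens.mem_iSup.2 ⟨⟨x, hx'⟩, hx x hx'⟩
  have hcompat : ∀ x y : U, vres A inf_le_left (a x) =
      vres A (inf_le_right : V x.1 x.2 ⊓ V y.1 y.2 ≤ _) (a y) := by
    intro x y
    apply P.cls_injective φ (P.res (inf_le_left.trans (leOfHom (f x.1 x.2))) s)
    have h1 := congrArg (P.assocRes φ (inf_le_left : V x.1 x.2 ⊓ V y.1 y.2 ≤ _)) (ha x)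
    have h2 := congrArg (P.assocRes φ (inf_le_right : V x.1 x.2 ⊓ V y.1 y.2 ≤ _)) (ha y)
    rw [cls_res, assocRes_assocRes, P.res_res] at h1 h2
    exact h1.trans h2.symm
  have hgl : ∀ i, ∃ c : Sec A U, ∀ x : U, rres A (leOfHom (f x.1 x.2)) c = a x i := by
    intro i
    obtain ⟨c, hc, -⟩ := A.existsUnique_gluing' (fun x : U => V x.1 x.2) U
      (fun x => f x.1 x.2) hcov (fun x => a x i) (fun x y => congrFun (hcompat x y) i)
    exact ⟨c, hc⟩
  choose c hc using hgl
  refine ⟨c, (P.assocSet φ).eq_of_locally_eq' (fun x : U => V x.1 x.2) U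
      (fun x => f x.1 x.2) hcov _ _ fun x => ?_⟩
  refine (P.cls_res φ (leOfHom (f x.1 x.2)) s c).trans (Eq.trans ?_ (ha x))
  congr 1
  ext i
  exact hc i x

/-- The coordinates of a section with respect to a section `s` of `P`: the inverse of `a ↦ [s, a]`. -/
def coord {U : Opens X} (s : P.Γ U) : P.AssocSec φ U ≃ (Fin n → Sec A U) :=
  (Equiv.ofBijective _ ⟨P.cls_injective φ s, P.cls_surjective φ s⟩).symm

lemma coord_cls {U : Opens X} (s : P.Γ U) (a : Fin n → Sec A U) :
    P.coord φ s (P.cls φ s a) = a :=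
  Equiv.ofBijective_symm_apply_apply _ ⟨P.cls_injective φ s, P.cls_surjective φ s⟩ a

lemma cls_coord {U : Opens X} (s : P.Γ U) (σ : P.AssocSec φ U) :
    P.cls φ s (P.coord φ s σ) = σ :=
  Equiv.ofBijective_apply_symm_apply _ ⟨P.cls_injective φ s, P.cls_surjective φ s⟩ σ

lemma coord_act {U : Opens X} (s : P.Γ U) (g : G.obj.obj (op U)) (σ : P.AssocSec φ U) :
    P.coord φ (P.act s g) σ = glVec (φ.app (op U) g⁻¹) (P.coord φ s σ) := by
  apply P.cls_injective φ (P.act s g)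
  rw [cls_coord, cls_act, ← glVec_mul, ← map_mul, mul_inv_cancel, map_one, glVec_one, cls_coord]

lemma coord_res {U V : Opens X} (h : V ≤ U) (s : P.Γ U) (σ : P.AssocSec φ U) :
    P.coord φ (P.res h s) (P.assocRes φ h σ) = vres A h (P.coord φ s σ) := by
  apply P.cls_injective φ (P.res h s)
  rw [cls_coord, ← cls_res, cls_coord]

/-- Tensorial maps over `U`: families of maps `P(V) → A(V)^n`, `V ⊆ U`, which satisfy
`f(s g) = φ(g⁻¹) f(s)` and commute with restrictions. -/
def Tens (U : Opens X) : AddSubgroup (∀ V : {V : Opens X // V ≤ U}, P.Γ V.1 → Fin n → Sec A V.1) where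
  carrier := {f | (∀ V h s g, f ⟨V, h⟩ (P.act s g) = glVec (φ.app (op V) g⁻¹) (f ⟨V, h⟩ s)) ∧
    ∀ V h W (k : W ≤ V) s, f ⟨W, k.trans h⟩ (P.res k s) = vres A k (f ⟨V, h⟩ s)}
  zero_mem' := ⟨fun V h s g => (Matrix.mulVec_zero _).symm, fun V h W k s => by
    ext i; exact (map_zero (rres A k)).symm⟩
  add_mem' {f g} hf hg := ⟨fun V h s x => by
      refine Eq.trans ?_ (Matrix.mulVec_add _ _ _).symm
      exact congrArg₂ (· + ·) (hf.1 V h s x) (hg.1 V h s x),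
    fun V h W k s => by
      refine (congrArg₂ (· + ·) (hf.2 V h W k s) (hg.2 V h W k s)).trans ?_
      ext i
      exact (map_add (rres A k) _ _).symm⟩
  neg_mem' {f} hf := ⟨fun V h s x => by
      refine Eq.trans ?_ (Matrix.mulVec_neg _ _).symm
      exact congrArg (- ·) (hf.1 V h s x),
    fun V h W k s => by
      refine (congrArg (- ·) (hf.2 V h W k s)).trans ?_
      ext i
      exact (map_neg (rres A k) _).symm⟩

instance (U : Opens X) : Module (Sec A U) (P.Tens φ U) where
  smul a t := ⟨fun V s => rres A V.2 a • t.1 V s, fun V h s x => by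
      refine (congrArg (rres A h a • ·) (t.2.1 V h s x)).trans ?_
      exact (Matrix.mulVec_smul _ _ _).symm,
    fun V h W k s => by
      refine (congrArg (rres A (k.trans h) a • ·) (t.2.2 V h W k s)).trans ?_
      ext i
      refine Eq.trans ?_ (map_mul (rres A k) _ _).symm
      exact congrArg (· * _) (ConcreteCategory.congr_hom
        (A.obj.map_comp (homOfLE h).op (homOfLE k).op) a)⟩
  one_smul t := by ext ⟨V, h⟩ s i; exact (congrArg (· * _) (map_one (rres A h))).trans (one_mul _)
  mul_smul a b t := by
    ext ⟨V, h⟩ s i; exact (congrArg (· * _) (map_mul (rres A h) a b)).trans (mul_assoc _ _ _)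
  smul_zero a := by ext ⟨V, h⟩ s i; exact mul_zero _
  smul_add a t t' := by ext ⟨V, h⟩ s i; exact mul_add _ _ _
  add_smul a b t := by
    ext ⟨V, h⟩ s i; exact (congrArg (· * _) (map_add (rres A h) a b)).trans (add_mul _ _ _)
  zero_smul t := by ext ⟨V, h⟩ s i; exact (congrArg (· * _) (map_zero (rres A h))).trans (zero_mul _)

/-- The tensorial map of a section of the associated sheaf. -/
def toTens {U : Opens X} (σ : P.AssocSec φ U) : P.Tens φ U :=
  ⟨fun V s => P.coord φ s (P.assocRes φ V.2 σ), fun _ _ s g => P.coord_act φ s g _,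
    fun _ h _ k s => (congrArg (P.coord φ (P.res k s)) (P.assocRes_assocRes φ h k σ).symm).trans
      (P.coord_res φ k s _)⟩

lemma Tens.cls_eq {U : Opens X}
    (t : P.Tens φ U) {V : Opens X} (h : V ≤ U) (s s' : P.Γ V) :
    P.cls φ s (t.1 ⟨V, h⟩ s) = P.cls φ s' (t.1 ⟨V, h⟩ s') := by
  obtain ⟨g, hg, -⟩ := P.existsUnique_act s s'
  rw [hg, t.2.1, cls_act, ← glVec_mul, ← map_mul, mul_inv_cancel, map_one, glVec_one]

lemma toTens_bijective (U : Opens X) : Function.Bijective (P.toTens φ (U := U)) := by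
  have sec (V : Opens X) (α : P.ι) : (P.Γ (V ⊓ P.cover α)) := P.res inf_le_right (P.natSec α)
  constructor
  · intro σ τ h
    refine (P.assocSet φ).eq_of_locally_eq' (fun α => U ⊓ P.cover α) U
      (fun α => homOfLE inf_le_left) (P.le_iSup_inf U) σ τ fun α => ?_
    have := congrArg (fun t => t.1 ⟨U ⊓ P.cover α, inf_le_left⟩ (sec U α)) h
    exact (P.coord φ (sec U α)).injective this
  · intro t
    obtain ⟨σ, hσ, -⟩ := (P.assocSet φ).existsUnique_gluing' (fun α => U ⊓ P.cover α) U
      (fun α => homOfLE inf_le_left) (P.le_iSup_inf U)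
      (fun α => P.cls φ (sec U α) (t.1 ⟨_, inf_le_left⟩ (sec U α))) (by
        intro α β
        refine (P.cls_res φ _ _ _).trans (Eq.trans ?_ (P.cls_res φ _ _ _).symm)
        rw [← t.2.2, ← t.2.2]
        exact Tens.cls_eq P φ t _ _ _)
    have key : ∀ V (h : V ≤ U) (s : P.Γ V), P.assocRes φ h σ = P.cls φ s (t.1 ⟨V, h⟩ s) := by
      intro V h s
      refine (P.assocSet φ).eq_of_locally_eq' (fun α => V ⊓ P.cover α) V
        (fun α => homOfLE inf_le_left) (P.le_iSup_inf V) _ _ fun α => ?_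
      have h1 := congrArg (P.assocRes φ (inf_le_inf_right (P.cover α) h)) (hσ α)
      refine (P.assocRes_assocRes φ _ _ _).trans
        (((P.assocRes_assocRes φ _ _ _).symm.trans h1).trans ?_)
      refine (P.cls_res φ _ _ _).trans (Eq.trans ?_ (P.cls_res φ _ _ _).symm)
      rw [← t.2.2, ← t.2.2]
      exact Tens.cls_eq P φ t _ _ _
    refine ⟨σ, ?_⟩
    ext ⟨V, h⟩ s i
    exact congrFun ((congrArg (P.coord φ s) (key V h s)).trans (P.coord_cls φ s _)) i

/-- Sections of the associated sheaf correspond to tensorial maps. -/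
def tensEquiv (U : Opens X) : P.AssocSec φ U ≃ P.Tens φ U :=
  Equiv.ofBijective _ (P.toTens_bijective φ U)

/-- The addition of the associated sheaf. It is the one for which the maps `a ↦ [s, a]` are
isomorphisms, see `frameIso`. -/
instance assocAddCommGroup (U : Opens X) : AddCommGroup (P.AssocSec φ U) :=
  (P.tensEquiv φ U).addCommGroup

/-- The multiplication by scalars of the associated sheaf. -/
instance assocModule (U : Opens X) : Module (Sec A U) (P.AssocSec φ U) :=
  (P.tensEquiv φ U).module (Sec A U)

lemma tensEquiv_add {U : Opens X} (σ τ : P.AssocSec φ U) :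
    P.toTens φ (σ + τ) = P.toTens φ σ + P.toTens φ τ :=
  (P.tensEquiv φ U).apply_symm_apply _

lemma tensEquiv_smul {U : Opens X} (a : Sec A U) (σ : P.AssocSec φ U) :
    P.toTens φ (a • σ) = a • P.toTens φ σ :=
  (P.tensEquiv φ U).apply_symm_apply _

lemma coord_eq {U : Opens X} (s : P.Γ U) (σ : P.AssocSec φ U) :
    P.coord φ s σ = (P.toTens φ σ).1 ⟨U, le_rfl⟩ s := by
  change _ = P.coord φ s (P.assocRes φ le_rfl σ)
  rw [assocRes_self]

lemma coord_add {U : Opens X} (s : P.Γ U) (σ τ : P.AssocSec φ U) :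
    P.coord φ s (σ + τ) = P.coord φ s σ + P.coord φ s τ := by
  rw [coord_eq, coord_eq, coord_eq, tensEquiv_add]
  rfl

lemma rres_self {U : Opens X} (a : Sec A U) : rres A le_rfl a = a :=
  ConcreteCategory.congr_hom (A.obj.map_id (op U)) a

lemma coord_smul {U : Opens X} (s : P.Γ U) (a : Sec A U) (σ : P.AssocSec φ U) :
    P.coord φ s (a • σ) = a • P.coord φ s σ := by
  rw [coord_eq, coord_eq, tensEquiv_smul]
  change rres A le_rfl a • _ = _
  rw [rres_self]

/-- The isomorphism `A(U)^n ≃ E(U)`, `a ↦ [s, a]`, defined by a section `s` of `P` over `U`. -/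
def frameIso {U : Opens X} (s : P.Γ U) : (Fin n → Sec A U) ≃ₗ[Sec A U] P.AssocSec φ U :=
  LinearEquiv.symm
    { P.coord φ s with
      map_add' := P.coord_add φ s
      map_smul' := P.coord_smul φ s }

lemma toTens_res {U V W : Opens X} (h : V ≤ U) (k : W ≤ V) (σ : P.AssocSec φ U) (s : P.Γ W) :
    (P.toTens φ (P.assocRes φ h σ)).1 ⟨W, k⟩ s = (P.toTens φ σ).1 ⟨W, k.trans h⟩ s :=
  congrArg (P.coord φ s) (P.assocRes_assocRes φ h k σ)

lemma assocRes_add {U V : Opens X} (h : V ≤ U) (σ τ : P.AssocSec φ U) :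
    P.assocRes φ h (σ + τ) = P.assocRes φ h σ + P.assocRes φ h τ := by
  apply (P.toTens_bijective φ V).1
  rw [tensEquiv_add]
  ext ⟨W, k⟩ s i
  refine (congrFun (P.toTens_res φ h k (σ + τ) s) i).trans ?_
  rw [tensEquiv_add]
  exact congrArg₂ (· + ·) (congrFun (P.toTens_res φ h k σ s) i).symm
    (congrFun (P.toTens_res φ h k τ s) i).symm

lemma assocRes_smul {U V : Opens X} (h : V ≤ U) (a : Sec A U) (σ : P.AssocSec φ U) :
    P.assocRes φ h (a • σ) = rres A h a • P.assocRes φ h σ := by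
  apply (P.toTens_bijective φ V).1
  rw [tensEquiv_smul]
  ext ⟨W, k⟩ s i
  refine (congrFun (P.toTens_res φ h k (a • σ) s) i).trans ?_
  rw [tensEquiv_smul]
  exact congrArg₂ (· * ·) (ConcreteCategory.congr_hom
        (A.obj.map_comp (homOfLE h).op (homOfLE k).op) a)
    (congrFun (P.toTens_res φ h k σ s) i).symm

/-- The associated sheaf as a presheaf of abelian groups. -/
def assocAb : (Opens X)ᵒᵖ ⥤ AddCommGrpCat.{u} where
  obj U := AddCommGrpCat.of (P.AssocSec φ U.unop)
  map f := AddCommGrpCat.ofHom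
    (AddMonoidHom.mk' (P.assocRes φ (leOfHom f.unop)) (P.assocRes_add φ (leOfHom f.unop)))
  map_id U := by ext σ; exact P.assocRes_self φ σ
  map_comp f g := by ext σ; exact (P.assocRes_assocRes φ _ _ σ).symm

instance (U : (Opens X)ᵒᵖ) : Module ((A.obj ⋙ forget₂ CommRingCat.{u} RingCat.{u}).obj U)
    ((P.assocAb φ).obj U) :=
  inferInstanceAs (Module (Sec A U.unop) (P.AssocSec φ U.unop))

lemma assocAb_isSheaf :
    Presheaf.IsSheaf (Opens.grothendieckTopology X) (P.assocAb φ) :=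
  (Presheaf.isSheaf_iff_isSheaf_forget _ _ (forget AddCommGrpCat.{u})).2
    (P.assocSet φ).property

/-- The associated sheaf as a presheaf of `A`-modules. -/
def assocModules : PMod A := PresheafOfModules.ofPresheaf (P.assocAb φ)
    (fun _ _ f a σ => P.assocRes_smul φ (leOfHom f.unop) a σ)

/-- The sheaf of `A`-modules `E` associated with `P` by the representation `φ`. -/
def assoc : SMod A where
  val := P.assocModules φ
  isSheaf := P.assocAb_isSheaf φ

end PrincipalSheaf

end Associated

section Connections

/-- A differential triad over an algebraized space: a sheaf `A` of commutative unital `K`-algebras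
on `X`, an `A`-module `Ω`, and a `K`-linear derivation `d : A ⟶ Ω`. -/
structure DifferentialTriad (K : Type v) [RCLike K] (X : TopCat.{u}) where
  A : X.Sheaf CommRingCat.{u}
  [algebra : ∀ U : Opens X, Algebra K (Sec A U)]
  rres_algebraMap : ∀ {U V : Opens X} (h : V ≤ U) (k : K),
    rres A h (algebraMap K (Sec A U) k) = algebraMap K (Sec A V) k
  Ω : SMod A
  d : ∀ U : Opens X, Sec A U →+ Ω.pre.Γ U
  d_res : ∀ {U V : Opens X} (h : V ≤ U) (a : Sec A U),
    d V (rres A h a) = Ω.pre.res h (d U a)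
  d_smul : ∀ {U : Opens X} (k : K) (a : Sec A U),
    d U (k • a) = algebraMap K (Sec A U) k • d U a
  d_mul : ∀ {U : Opens X} (a b : Sec A U), d U (a * b) = a • d U b + b • d U a

attribute [instance] DifferentialTriad.algebra

variable {K : Type v} [RCLike K] {T : DifferentialTriad K X}

/-- A sheaf of groups of Lie type: a sheaf of groups `G` with a representation `ρ` in an `A`-module
of Lie algebras `L` and a Maurer-Cartan differential `∂ : G ⟶ Ω ⊗_A L`. -/
structure LieTypeGroup (T : DifferentialTriad K X) where
  G : X.Sheaf GrpCat.{u}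
  L : LiePresheaf T.A
  L_isSheaf : Presheaf.IsSheaf (Opens.grothendieckTopology X) L.ab
  ρ : LieRep G.obj L
  mc : ∀ U : Opens X, G.obj.obj (op U) → (tensorSheaf T.Ω.pre L.pre).pre.Γ U
  mc_res : ∀ {U V : Opens X} (h : V ≤ U) (g : G.obj.obj (op U)),
    mc V (gres G h g) = (tensorSheaf T.Ω.pre L.pre).pre.res h (mc U g)
  mc_mul : ∀ {U : Opens X} (s t : G.obj.obj (op U)),
    mc U (s * t) = ρ.tensorAct T.Ω.pre t⁻¹ (mc U s) + mc U t

/-- The identification `M_n(Ω(U)) → (Ω ⊗_A M_n(A))(U)`, `(θ_ij) ↦ ∑ θ_ij ⊗ E_ij`, where the `E_ij`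
are the matrix units. -/
def matForm (T : DifferentialTriad K X) {n : ℕ} {U : Opens X}
    (θ : Fin n → Fin n → T.Ω.pre.Γ U) : (tensorSheaf T.Ω.pre (matLie n T.A).pre).pre.Γ U :=
  ∑ i, ∑ j, tmul T.Ω.pre (matLie n T.A).pre (θ i j)
    (Matrix.single i j 1 : Matrix (Fin n) (Fin n) (Sec T.A U))

/-- The Maurer-Cartan differential `a ↦ a⁻¹ da` of `GL(n, A)`. -/
def glMC (T : DifferentialTriad K X) {n : ℕ} {U : Opens X} (a : GL (Fin n) (Sec T.A U)) :
    (tensorSheaf T.Ω.pre (matLie n T.A).pre).pre.Γ U :=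
  matForm T fun i j => ∑ k, (a⁻¹).1 i k • T.d U (a.1 k j)

/-- The representation `φ` of `G` is of Lie type by means of the morphism of sheaves of Lie algebras
`φbar`: it is compatible with the Maurer-Cartan differentials and with the representations `ρ` and
`Ad`. -/
structure IsLieType (G : LieTypeGroup T) {n : ℕ} (φ : G.G.obj ⟶ glPre n T.A)
    (φbar : LiePresheaf.Hom G.L (matLie n T.A)) : Prop where
  mc_comp : ∀ (U : Opens X) (g : G.G.obj.obj (op U)),
    glMC T (φ.app (op U) g) = tensorMap T.Ω.pre φbar.pre U (G.mc U g)
  comp_rho : ∀ (U : Opens X) (g : G.G.obj.obj (op U)) (x : G.L.obj U),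
    φbar.app U (G.ρ.app U g x) = (Ad n T.A).app U (φ.app (op U) g) (φbar.app U x)

/-- A connection on the principal sheaf `P`: a morphism of sheaves of sets `D : P ⟶ Ω ⊗_A L` with
`D(s g) = ρ(g⁻¹).D(s) + ∂(g)`. -/
structure PConnection (G : LieTypeGroup T) (P : PrincipalSheaf.{u, w} G.G) where
  app : ∀ U : Opens X, P.Γ U → (tensorSheaf T.Ω.pre G.L.pre).pre.Γ U
  app_res : ∀ {U V : Opens X} (h : V ≤ U) (s : P.Γ U),
    app V (P.res h s) = (tensorSheaf T.Ω.pre G.L.pre).pre.res h (app U s)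
  app_act : ∀ {U : Opens X} (s : P.Γ U) (g : G.G.obj.obj (op U)),
    app U (P.act s g) = G.ρ.tensorAct T.Ω.pre g⁻¹ (app U s) + G.mc U g

/-- The section `θ_α = (1 ⊗ φbar)(ω_α)` over `U_α`, where `ω_α = D(s_α)` is the local connection form
of `D`. -/
def PConnection.inducedForm {G : LieTypeGroup T} {P : PrincipalSheaf.{u, w} G.G}
    (D : PConnection G P) {n : ℕ} (φbar : LiePresheaf.Hom G.L (matLie n T.A)) (α : P.ι) :
    (tensorSheaf T.Ω.pre (matLie n T.A).pre).pre.Γ (P.cover α) :=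
  tensorMap T.Ω.pre φbar.pre (P.cover α) (D.app (P.cover α) (P.natSec α))

/-- A vector sheaf of rank `n`: an `A`-module locally isomorphic to `A^n`. -/
def IsVectorSheaf {A : X.Sheaf CommRingCat.{u}} (n : ℕ) (E : SMod A) : Prop :=
  ∀ x : X, ∃ U : Opens X, x ∈ U ∧
    ∃ ψ : ∀ V : Opens X, V ≤ U → ((Fin n → Sec A V) ≃ₗ[Sec A V] E.pre.Γ V),
      ∀ (V W : Opens X) (h : V ≤ U) (k : W ≤ V) (a : Fin n → Sec A V),
        E.pre.res k (ψ V h a) = ψ W (k.trans h) (vres A k a)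

/-- An `A`-connection on the `A`-module `E`: a `K`-linear morphism `∇ : E ⟶ E ⊗_A Ω` with
`∇(a s) = a ∇(s) + s ⊗ da`. -/
structure AConnection (T : DifferentialTriad K X) (E : SMod T.A) where
  app : ∀ U : Opens X, E.pre.Γ U →+ (tensorSheaf E.pre T.Ω.pre).pre.Γ U
  app_res : ∀ {U V : Opens X} (h : V ≤ U) (s : E.pre.Γ U),
    app V (E.pre.res h s) = (tensorSheaf E.pre T.Ω.pre).pre.res h (app U s)
  app_smul : ∀ {U : Opens X} (k : K) (s : E.pre.Γ U),
    app U (algebraMap K (Sec T.A U) k • s) = algebraMap K (Sec T.A U) k • app U s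
  leibniz : ∀ {U : Opens X} (a : Sec T.A U) (s : E.pre.Γ U),
    app U (a • s) = a • app U s + tmul E.pre T.Ω.pre s (T.d U a)

/-- The basis `e_1, …, e_n` of `E(U)` defined by a section `s` of `P` over `U`. -/
def PrincipalSheaf.frame {A : X.Sheaf CommRingCat.{u}} {n : ℕ} {G : X.Sheaf GrpCat.{u}}
    (P : PrincipalSheaf.{u, w} G) (φ : G.obj ⟶ glPre n A) {U : Opens X} (s : P.Γ U) (j : Fin n) :
    (P.assoc φ).pre.Γ U :=
  P.frameIso φ s (Pi.single j 1)

/-- `θ` is the connection form of `∇` with respect to the basis defined by the section `s` of `P`: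
`θ` corresponds to the matrix `(θ_ij)` with `∇ e_j = ∑ e_i ⊗ θ_ij`. -/
def AConnection.HasForm {G : X.Sheaf GrpCat.{u}} {P : PrincipalSheaf.{u, w} G} {n : ℕ}
    {φ : G.obj ⟶ glPre n T.A} (D : AConnection T (P.assoc φ)) {U : Opens X} (s : P.Γ U)
    (θ : (tensorSheaf T.Ω.pre (matLie n T.A).pre).pre.Γ U) : Prop :=
  ∃ Θ : Fin n → Fin n → T.Ω.pre.Γ U, matForm T Θ = θ ∧
    ∀ j, D.app U (P.frame φ s j) =
      ∑ i, tmul (P.assoc φ).pre T.Ω.pre (P.frame φ s i) (Θ i j)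

end Connections

end ADG

end

namespace ADG

variable {X : TopCat.{u}}

/-! ### Restriction and gluing for sheaves of modules. -/

section Restriction

variable {A : X.Sheaf CommRingCat.{u}}

/-! Wherever `P` has a section `s`, the sheaf `E` is free with basis e_i = [s, ε_i], where ε_i is
the standard basis of A^n, and `D` yields a matrix of forms θ = (1 ⊗ φbar)(D(s)). Additivity and the
Leibniz rule then force ∇(∑ c_i e_i) = ∑ e_i ⊗ (dc_i + ∑_j c_j θ_ij). Uniqueness follows, since a
form has only one matrix (`matForm_injective`) and the open sets U_α cover X.

For existence, the right-hand side must not depend on s. Replace s by sg and put h = φ(g). The Lie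
type conditions turn D(sg) = ρ(g⁻¹).D(s) + ∂(g) into θ' = h⁻¹θh + h⁻¹dh, that is, hθ' = θh + dh;
moreover e' = eh and c = hc'. Hence d(hc') + θhc' = h(dc' + θ'c'), and moving h across the tensor
sign gives equality (`sum_connection_transform`). Two sections of `P` over the same open set always
differ by a section of `G`, so the local values agree on overlaps and glue (`localConn_eq`,
`exists_conn`). The transformation law of the θ_α is the same computation applied to s_β = s_α g_αβ,
and the cocycle of `E` comes from [sg, a] = [s, φ(g)a].

The tensor products here are sheafifications, so their sections are only locally sums of pure
tensors. `tensorSheaf_hom_ext` reduces identities to pure tensors, and `matCoef` extracts the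
entries of a matrix-valued form. -/

lemma PMod.res_res (M : PMod A) {U V W : Opens X} (h : V ≤ U) (k : W ≤ V) (s : M.Γ U) :
    M.res k (M.res h s) = M.res (k.trans h) s :=
  (ConcreteCategory.congr_hom (M.presheaf.map_comp (homOfLE h).op (homOfLE k).op) s).symm

lemma PMod.res_self (M : PMod A) {U : Opens X} (s : M.Γ U) : M.res le_rfl s = s :=
  ConcreteCategory.congr_hom (M.presheaf.map_id (op U)) s

lemma PMod.res_smul (M : PMod A) {U V : Opens X} (h : V ≤ U) (a : Sec A U) (s : M.Γ U) :
    M.res h (a • s) = rres A h a • M.res h s :=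
  M.map_smul (homOfLE h).op a s

lemma SMod.eq_of_locally_eq (E : SMod A) {ι : Type*} {U : Opens X} (V : ι → Opens X)
    (h : ∀ i, V i ≤ U) (hU : U ≤ ⨆ i, V i) {s t : E.pre.Γ U}
    (hst : ∀ i, E.pre.res (h i) s = E.pre.res (h i) t) : s = t :=
  TopCat.Sheaf.eq_of_locally_eq' ((SheafOfModules.toSheaf _).obj E) V U
    (fun i => homOfLE (h i)) hU s t hst

lemma SMod.exists_gluing (E : SMod A) {ι : Type*} {U : Opens X} (V : ι → Opens X)
    (h : ∀ i, V i ≤ U) (hU : U ≤ ⨆ i, V i) (s : ∀ i, E.pre.Γ (V i))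
    (hs : ∀ i j, E.pre.res (inf_le_left : V i ⊓ V j ≤ _) (s i) =
      E.pre.res (inf_le_right : V i ⊓ V j ≤ _) (s j)) :
    ∃ t : E.pre.Γ U, ∀ i, E.pre.res (h i) t = s i := by
  obtain ⟨t, ht, -⟩ := TopCat.Sheaf.existsUnique_gluing' ((SheafOfModules.toSheaf _).obj E) V U
    (fun i => homOfLE (h i)) hU s (fun i j => hs i j)
  exact ⟨t, fun i => ht i⟩

end Restriction

/-! ### Pure tensors in the sheaf `M ⊗_A N`. -/

section Tensor

variable {A : X.Sheaf CommRingCat.{u}} (M N : PMod A)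

lemma tmul_add {U : Opens X} (m : M.Γ U) (n n' : N.Γ U) :
    tmul M N m (n + n') = tmul M N m n + tmul M N m n' :=
  (congrArg ((toTensorSheaf M N).app (op U)) (TensorProduct.tmul_add m n n')).trans
    (map_add ((toTensorSheaf M N).app (op U)).hom _ _)

lemma add_tmul {U : Opens X} (m m' : M.Γ U) (n : N.Γ U) :
    tmul M N (m + m') n = tmul M N m n + tmul M N m' n :=
  (congrArg ((toTensorSheaf M N).app (op U)) (TensorProduct.add_tmul m m' n)).trans
    (map_add ((toTensorSheaf M N).app (op U)).hom _ _)

lemma tmul_smul_left {U : Opens X} (a : Sec A U) (m : M.Γ U) (n : N.Γ U) :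
    tmul M N (a • m) n = tmul M N m (a • n) :=
  congrArg ((toTensorSheaf M N).app (op U)) (TensorProduct.smul_tmul a m n)

lemma smul_tmul {U : Opens X} (a : Sec A U) (m : M.Γ U) (n : N.Γ U) :
    a • tmul M N m n = tmul M N m (a • n) := by
  -- `toTensorSheaf` is only a morphism of presheaves of abelian groups. The unit `η` of the
  -- sheafification of modules has the same underlying maps and is linear over `A`.
  let η := PresheafOfModules.sheafificationHomEquiv (R := ringSheaf A) (𝟙 (ringSheaf A).obj)
    (𝟙 ((PresheafOfModules.sheafification (R := ringSheaf A) (𝟙 (ringSheaf A).obj)).obj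
      (tensorPre M N)))
  have h := (η.app (op U)).hom.map_smul a (m ⊗ₜ[Sec A U] n : (M.Γ U) ⊗[Sec A U] (N.Γ U))
  refine Eq.trans h.symm ?_
  exact congrArg ((toTensorSheaf M N).app (op U)) (TensorProduct.tmul_smul a m n).symm

lemma res_tmul {U V : Opens X} (h : V ≤ U) (m : M.Γ U) (n : N.Γ U) :
    (tensorSheaf M N).pre.res h (tmul M N m n) = tmul M N (M.res h m) (N.res h n) :=
  (ConcreteCategory.congr_hom ((toTensorSheaf M N).naturality (homOfLE h).op)
    (m ⊗ₜ[Sec A U] n : (M.Γ U) ⊗[Sec A U] (N.Γ U))).symm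

variable {M N}

/-- A section of the sheafification comes locally from the presheaf, where it is a finite sum of
pure tensors. Compared with induction on a tensor product of modules, the new condition is `loc`; it
compares different open sets, so the motive has to range over all of them. -/
lemma tensorSheaf_induction {motive : ∀ U : Opens X, (tensorSheaf M N).pre.Γ U → Prop}
    (zero : ∀ U, motive U 0)
    (tmul : ∀ U m n, motive U (tmul M N m n))
    (add : ∀ U x y, motive U x → motive U y → motive U (x + y))
    (loc : ∀ U x, (∀ p ∈ U, ∃ (V : Opens X) (h : V ≤ U), p ∈ V ∧
      motive V ((tensorSheaf M N).pre.res h x)) → motive U x)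
    (U : Opens X) (x : (tensorSheaf M N).pre.Γ U) : motive U x := by
  apply loc
  intro p hp
  have : Presheaf.IsLocallySurjective (Opens.grothendieckTopology X) (toTensorSheaf M N) :=
    inferInstanceAs (Presheaf.IsLocallySurjective _ (toSheafify _ _))
  obtain ⟨V, f, ⟨t, ht⟩, hV⟩ := Presheaf.imageSieve_mem (Opens.grothendieckTopology X)
    (toTensorSheaf M N) (U := op U) x p hp
  refine ⟨V, leOfHom f, hV, ?_⟩
  suffices h : ∀ t : (M.Γ V) ⊗[Sec A V] (N.Γ V), motive V ((toTensorSheaf M N).app (op V) t) by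
    have := h t
    rw [ht] at this
    exact this
  intro t
  induction t using TensorProduct.induction_on with
  | zero =>
    have h0 : (toTensorSheaf M N).app (op V) (0 : (M.Γ V) ⊗[Sec A V] (N.Γ V)) =
        (0 : (tensorSheaf M N).pre.Γ V) := map_zero ((toTensorSheaf M N).app (op V)).hom
    rw [h0]; exact zero V
  | tmul m n => exact tmul V m n
  | add x y hx hy =>
    have h1 : (toTensorSheaf M N).app (op V) (x + y) =
        ((toTensorSheaf M N).app (op V) x + (toTensorSheaf M N).app (op V) y :
          (tensorSheaf M N).pre.Γ V) := map_add ((toTensorSheaf M N).app (op V)).hom x y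
    rw [h1]; exact add V _ _ hx hy

/-- Two families of additive maps from `M ⊗_A N` into a sheaf of modules which commute with
restrictions agree as soon as they agree on the sections `m ⊗ n`. -/
lemma tensorSheaf_hom_ext {F : SMod A} {U : Opens X}
    {f g : ∀ V : Opens X, V ≤ U → ((tensorSheaf M N).pre.Γ V →+ F.pre.Γ V)}
    (hf : ∀ (V W : Opens X) (h : V ≤ U) (k : W ≤ V) x,
      F.pre.res k (f V h x) = f W (k.trans h) ((tensorSheaf M N).pre.res k x))
    (hg : ∀ (V W : Opens X) (h : V ≤ U) (k : W ≤ V) x,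
      F.pre.res k (g V h x) = g W (k.trans h) ((tensorSheaf M N).pre.res k x))
    (hfg : ∀ V (h : V ≤ U) m n, f V h (tmul M N m n) = g V h (tmul M N m n))
    (x : (tensorSheaf M N).pre.Γ U) : f U le_rfl x = g U le_rfl x := by
  refine tensorSheaf_induction (motive := fun V x => ∀ h : V ≤ U, f V h x = g V h x)
    ?_ ?_ ?_ ?_ U x le_rfl
  · intro V h; rw [map_zero, map_zero]
  · intro V m n h; exact hfg V h m n
  · intro V x y hx hy h; rw [map_add, map_add, hx h, hy h]
  · intro V x hx h
    choose W k hp hW using hx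
    refine F.eq_of_locally_eq (fun p : V => W p.1 p.2) (fun p => k p.1 p.2)
      (fun p hp' => Opens.mem_iSup.2 ⟨⟨p, hp'⟩, hp p hp'⟩) fun p => ?_
    rw [hf, hg, hW]

/-- This is the naturality of the map from a presheaf to its sheafification. -/
lemma tensorMap_tmul (M : PMod A) {N N' : PMod A} (f : N ⟶ N') {U : Opens X} (m : M.Γ U)
    (n : N.Γ U) :
    tensorMap M f U (tmul M N m n) = tmul M N' m ((f.app (op U)).hom n) :=
  (ConcreteCategory.congr_hom (congrArg (fun α : (tensorPre M N).presheaf ⟶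
      (tensorSheaf M N').pre.presheaf => α.app (op U))
    (toSheafify_naturality (Opens.grothendieckTopology X)
      ((PresheafOfModules.toPresheaf _).map (M ◁ f))))
    (m ⊗ₜ[Sec A U] n : (M.Γ U) ⊗[Sec A U] (N.Γ U))).symm

lemma res_tensorMap (M : PMod A) {N N' : PMod A} (f : N ⟶ N') {U V : Opens X} (h : V ≤ U)
    (x : (tensorSheaf M N).pre.Γ U) :
    (tensorSheaf M N').pre.res h (tensorMap M f U x) =
      tensorMap M f V ((tensorSheaf M N).pre.res h x) :=
  (ConcreteCategory.congr_hom (((PresheafOfModules.toPresheaf _).map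
    ((PresheafOfModules.sheafification (R := ringSheaf A) (𝟙 (ringSheaf A).obj)).map
    (M ◁ f)).val).naturality (homOfLE h).op) x).symm

end Tensor

/-! ### Compatibility of the action on `M ⊗_A L` with restrictions. -/

section TensorAct

variable {A : X.Sheaf CommRingCat.{u}} {G : (Opens X)ᵒᵖ ⥤ GrpCat.{u}} {L : LiePresheaf A}

/-- The restriction of `extendLocally F U f hf x` to `V` is `f V t` if `x` is given by `t` on `V`. -/
lemma extendLocally_res {T : (Opens X)ᵒᵖ ⥤ AddCommGrpCat.{u}} (F : X.Sheaf AddCommGrpCat.{u})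
    {U V : Opens X} (hV : V ≤ U) (f : ∀ V : Opens X, V ≤ U → (T.obj (op V) →+ F.obj.obj (op V)))
    (hf : ∀ {V W : Opens X} (h : V ≤ U) (k : W ≤ V) (t : T.obj (op V)),
      f W (k.trans h) (T.map (homOfLE k).op t) = F.obj.map (homOfLE k).op (f V h t))
    (x : (sheafify (Opens.grothendieckTopology X) T).obj (op U)) (t : T.obj (op V))
    (ht : (toSheafify (Opens.grothendieckTopology X) T).app (op V) t =
      (sheafify (Opens.grothendieckTopology X) T).map (homOfLE hV).op x) :
    F.obj.map (homOfLE hV).op (extendLocally F U f hf x) = f V hV t := by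
  unfold extendLocally
  extract_lets W hWU hWV hW φ
  -- `W V` is the intersection of `U` and `V`, hence has the same points as `V` here, but not by
  -- definition. Restriction along the two inclusions passes from one to the other.
  have hVW : V ≤ W V := fun x hx => ⟨⟨x, hV hx⟩, hx, rfl⟩
  have h1 : (sheafifyLift (Opens.grothendieckTopology X) φ (locPre_isSheaf U F)).app (op V)
      ((toSheafify (Opens.grothendieckTopology X) T).app (op V) t) = φ.app (op V) t := by
    rw [← ConcreteCategory.comp_apply, ← NatTrans.comp_app, toSheafify_sheafifyLift]
  have h2 : (sheafifyLift (Opens.grothendieckTopology X) φ (locPre_isSheaf U F)).app (op V)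
      ((sheafify (Opens.grothendieckTopology X) T).map (homOfLE hV).op x) =
      F.obj.map (homOfLE (Set.image_mono fun y hy => hV hy : W V ≤ W U)).op
        ((sheafifyLift (Opens.grothendieckTopology X) φ (locPre_isSheaf U F)).app (op U) x) :=
    ConcreteCategory.congr_hom
    ((sheafifyLift (Opens.grothendieckTopology X) φ (locPre_isSheaf U F)).naturality
      (homOfLE hV).op) x
  rw [← ht, h1] at h2
  have h3 := hf (hWU V) hVW (T.map (homOfLE (hWV V)).op t)
  rw [← ConcreteCategory.comp_apply, ← T.map_comp] at h3
  have h4 : (homOfLE (hWV V)).op ≫ (homOfLE hVW).op = 𝟙 (op V) := rfl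
  rw [h4, T.map_id] at h3
  refine Eq.trans ?_ h3.symm
  refine Eq.trans ?_ (congrArg (fun y => F.obj.map (homOfLE hVW).op y) h2).symm
  have hF : ∀ {U₁ U₂ U₃ : Opens X} (h : U₂ ≤ U₁) (k : U₃ ≤ U₂) (y : F.obj.obj (op U₁)),
      F.obj.map (homOfLE k).op (F.obj.map (homOfLE h).op y) =
        F.obj.map (homOfLE (k.trans h)).op y := fun h k y =>
    (ConcreteCategory.congr_hom (F.obj.map_comp (homOfLE h).op (homOfLE k).op) y).symm
  exact (hF hW hV _).trans (hF _ hVW _).symm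

variable (ρ : LieRep G L) (M : PMod A)

/-- `tensorAct` is built separately on each open set, so this compatibility is not automatic. On a
small open set where x comes from an element t of the presheaf tensor product, both sides are the
canonical image of 1 ⊗ ρ(g) applied to t, with g restricted to that set. -/
lemma LieRep.res_tensorAct {U V : Opens X} (h : V ≤ U) (g : G.obj (op U))
    (x : (tensorSheaf M L.pre).pre.Γ U) :
    (tensorSheaf M L.pre).pre.res h (ρ.tensorAct M g x) =
      ρ.tensorAct M (G.map (homOfLE h).op g) ((tensorSheaf M L.pre).pre.res h x) := by
  have : Presheaf.IsLocallySurjective (Opens.grothendieckTopology X) (toTensorSheaf M L.pre) :=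
    inferInstanceAs (Presheaf.IsLocallySurjective _ (toSheafify _ _))
  have hS := Presheaf.imageSieve_mem (Opens.grothendieckTopology X)
    (toTensorSheaf M L.pre) (U := op V) ((tensorSheaf M L.pre).pre.res h x)
  choose W f ht hW using hS
  refine (tensorSheaf M L.pre).eq_of_locally_eq (fun p : V => W p.1 p.2)
    (fun p => leOfHom (f p.1 p.2)) (fun p hp' => Opens.mem_iSup.2 ⟨⟨p, hp'⟩, hW p hp'⟩) fun p => ?_
  obtain ⟨t, ht⟩ := ht p.1 p.2
  have k := leOfHom (f p.1 p.2)
  refine (PMod.res_res _ _ _ _).trans ?_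
  refine (extendLocally_res ((SheafOfModules.toSheaf _).obj (tensorSheaf M L.pre)) (k.trans h)
    (ρ.actFam M g) (ρ.actFam_res M g) x t
      (Eq.trans ht (PMod.res_res (tensorSheaf M L.pre).pre h k x))).trans ?_
  refine Eq.trans ?_ (extendLocally_res ((SheafOfModules.toSheaf _).obj (tensorSheaf M L.pre)) k
    (ρ.actFam M (G.map (homOfLE h).op g)) (ρ.actFam_res M _) _ t ht).symm
  unfold LieRep.actFam
  rw [← ConcreteCategory.comp_apply, ← G.map_comp]
  rfl

end TensorAct

/-! ### Entries of sections of `M ⊗_A M_n(A)`. -/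

section MatrixForms

variable {A : X.Sheaf CommRingCat.{u}} (M : SMod A) {n : ℕ}

/-- The map `m ⊗ x ↦ x_ij m` of the presheaf `U ↦ M(U) ⊗ M_n(A(U))` into `M`. -/
noncomputable def preCoef (i j : Fin n) :
    (tensorPre M.pre (matLie n A).pre).presheaf ⟶ M.pre.presheaf where
  app U := AddCommGrpCat.ofHom (TensorProduct.liftAddHom (R := Sec A U.unop)
    (M := M.pre.Γ U.unop) (N := Matrix (Fin n) (Fin n) (Sec A U.unop))
    (AddMonoidHom.mk' (fun m => AddMonoidHom.mk' (fun x => x i j • m)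
        fun x y => add_smul (x i j) (y i j) m)
      fun m m' => by ext x; exact smul_add (x i j) m m')
    (fun a m x => by
      change x i j • a • m = (a * x i j) • m
      rw [smul_smul, mul_comm]))
  naturality U V f := by
    ext t
    have h : V.unop ≤ U.unop := leOfHom f.unop
    let r : (M.pre.Γ U.unop) ⊗[Sec A U.unop] Matrix (Fin n) (Fin n) (Sec A U.unop) →+
        (M.pre.Γ V.unop) ⊗[Sec A V.unop] Matrix (Fin n) (Fin n) (Sec A V.unop) :=
      ((tensorPre M.pre (matLie n A).pre).presheaf.map f).hom
    refine DFunLike.congr_fun (tensor_addHom_ext (R := Sec A U.unop) (M := M.pre.Γ U.unop)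
      (N := Matrix (Fin n) (Fin n) (Sec A U.unop)) (P := M.pre.Γ V.unop)
      (f := AddMonoidHom.comp _ r) (g := AddMonoidHom.comp (M.pre.res h) _) fun m x => ?_) t
    exact (PMod.res_smul M.pre h (x i j) m).symm

/-- The coefficients of the sections of `M ⊗_A M_n(A)`. -/
noncomputable def matCoef (i j : Fin n) (U : Opens X) :
    (tensorSheaf M.pre (matLie n A).pre).pre.Γ U →+ M.pre.Γ U :=
  ((sheafifyLift (Opens.grothendieckTopology X) (preCoef M i j) M.isSheaf).app (op U)).hom

lemma matCoef_tmul (i j : Fin n) {U : Opens X} (m : M.pre.Γ U)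
    (x : Matrix (Fin n) (Fin n) (Sec A U)) :
    matCoef M i j U (tmul M.pre (matLie n A).pre m x) = x i j • m := by
  exact ConcreteCategory.congr_hom (congrArg (fun α : (tensorPre M.pre
    (matLie n A).pre).presheaf ⟶ M.pre.presheaf => α.app (op U))
    (toSheafify_sheafifyLift (Opens.grothendieckTopology X) (preCoef M i j) M.isSheaf))
    (m ⊗ₜ[Sec A U] x : (M.pre.Γ U) ⊗[Sec A U] (Matrix (Fin n) (Fin n) (Sec A U)))

lemma res_matCoef (i j : Fin n) {U V : Opens X} (h : V ≤ U)
    (x : (tensorSheaf M.pre (matLie n A).pre).pre.Γ U) :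
    M.pre.res h (matCoef M i j U x) =
      matCoef M i j V ((tensorSheaf M.pre (matLie n A).pre).pre.res h x) :=
  (ConcreteCategory.congr_hom ((sheafifyLift (Opens.grothendieckTopology X) (preCoef M i j)
    M.isSheaf).naturality (homOfLE h).op) x).symm

/-- Both sides are additive in x and compatible with restrictions, so it is enough to take x = m ⊗
y, where the formula gives the entries of the product g y g⁻¹. -/
lemma matCoef_tensorAct (i j : Fin n) {U : Opens X} (g : GL (Fin n) (Sec A U))
    (x : (tensorSheaf M.pre (matLie n A).pre).pre.Γ U) :
    matCoef M i j U ((Ad n A).tensorAct M.pre (G := glPre n A) (U := U) g x) =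
      ∑ k, ∑ l, (g.1 i k * (g⁻¹).1 l j) • matCoef M k l U x := by
  -- The extension principle compares families over all `V ≤ U`, so `g` is replaced by the family of
  -- its restrictions; `hgr_self` recovers `g` over `U` at the end.
  let gr (V : Opens X) (h : V ≤ U) : GL (Fin n) (Sec A V) := (glPre n A).map (homOfLE h).op g
  have hgr (V W : Opens X) (h : V ≤ U) (k : W ≤ V) :
      (glPre n A).map (homOfLE k).op (gr V h) = gr W (k.trans h) :=
    (ConcreteCategory.congr_hom ((glPre n A).map_comp (homOfLE h).op (homOfLE k).op) g).symm
  have hgr_self : gr U le_rfl = g := ConcreteCategory.congr_hom ((glPre n A).map_id (op U)) g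
  have key := tensorSheaf_hom_ext (M := M.pre) (N := (matLie n A).pre) (F := M) (U := U)
    (f := fun V h => (matCoef M i j V).comp ((Ad n A).tensorAct M.pre (U := V) (gr V h)))
    (g := fun V h => ∑ k, ∑ l, (DistribSMul.toAddMonoidHom (M.pre.Γ V)
      ((gr V h).1 i k * ((gr V h)⁻¹).1 l j)).comp (matCoef M k l V))
    (fun V W h k x => by
      change M.pre.res k (matCoef M i j V ((Ad n A).tensorAct M.pre (gr V h) x)) =
        matCoef M i j W ((Ad n A).tensorAct M.pre (gr W (k.trans h)) _)
      rw [res_matCoef, LieRep.res_tensorAct, hgr])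
    (fun V W h k x => by
      simp only [AddMonoidHom.finsetSum_apply, AddMonoidHom.comp_apply, map_sum]
      refine Finset.sum_congr rfl fun p _ => Finset.sum_congr rfl fun q _ => ?_
      refine (PMod.res_smul _ _ _ _).trans ?_
      have h1 : (gr W (k.trans h))⁻¹ = Matrix.GeneralLinearGroup.map (rres A k) (gr V h)⁻¹ := by
        rw [map_inv]
        exact congrArg _ (hgr V W h k).symm
      change _ = ((gr W (k.trans h)).1 i p * ((gr W (k.trans h))⁻¹).1 q j) •
        matCoef M p q W ((tensorSheaf M.pre (matLie n A).pre).pre.res k x)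
      rw [res_matCoef, map_mul, h1, ← hgr V W h k]
      rfl)
    (fun V h m (y : Matrix (Fin n) (Fin n) (Sec A V)) => by
      simp only [AddMonoidHom.finsetSum_apply, AddMonoidHom.comp_apply]
      refine (congrArg (matCoef M i j V) (LieRep.tensorAct_tmul _ _ _ _ _)).trans ?_
      refine (matCoef_tmul _ _ _ _ _).trans ?_
      refine Eq.trans ?_ (Finset.sum_congr rfl fun p _ => Finset.sum_congr rfl fun q _ =>
        (congrArg _ (matCoef_tmul M p q m y).symm))
      refine (congrArg (fun z : Matrix (Fin n) (Fin n) (Sec A V) => z i j • m)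
        (glConj_apply (gr V h) y)).trans ?_
      change _ = ∑ p, ∑ q, ((gr V h).1 i p * ((gr V h)⁻¹).1 q j) • y p q • m
      simp only [smul_smul, ← Finset.sum_smul, Matrix.mul_apply, Finset.sum_mul]
      rw [Finset.sum_comm]
      simp only [mul_right_comm]) x
  simp only [AddMonoidHom.finsetSum_apply, AddMonoidHom.comp_apply, hgr_self] at key
  exact key

variable {M}

/-- A section is rebuilt from its entries: the sum over i, j of (entry ij) ⊗ E_ij is the identity.
On m ⊗ x this is the expansion of x in matrix units, after the scalars x_ij have moved across the
tensor sign. -/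
lemma matCoef_ext {U : Opens X} {x y : (tensorSheaf M.pre (matLie n A).pre).pre.Γ U}
    (h : ∀ i j, matCoef M i j U x = matCoef M i j U y) : x = y := by
  have key := tensorSheaf_hom_ext (M := M.pre) (N := (matLie n A).pre)
    (F := tensorSheaf M.pre (matLie n A).pre) (U := U)
    (f := fun V _ => ∑ i, ∑ j, (AddMonoidHom.mk' (fun m => tmul M.pre (matLie n A).pre m
      (Matrix.single i j 1 : Matrix (Fin n) (Fin n) (Sec A V)))
      fun m m' => add_tmul _ _ m m' _).comp (matCoef M i j V))
    (g := fun V _ => AddMonoidHom.id _)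
    (fun V W h k x => by
      simp only [AddMonoidHom.finsetSum_apply, AddMonoidHom.comp_apply, map_sum]
      refine Finset.sum_congr rfl fun i _ => Finset.sum_congr rfl fun j _ => ?_
      refine (res_tmul _ _ _ _ _).trans ?_
      rw [res_matCoef]
      refine congrArg (tmul M.pre (matLie n A).pre _) ?_
      change (Matrix.single i j (1 : Sec A V)).map (rres A k) = _
      rw [Matrix.map_single, map_one])
    (fun V W h k x => rfl)
    (fun V h m x => by
      simp only [AddMonoidHom.finsetSum_apply, AddMonoidHom.comp_apply, AddMonoidHom.id_apply]
      change ∑ i, ∑ j, tmul M.pre (matLie n A).pre (matCoef M i j V _) _ = _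
      let τ : Matrix (Fin n) (Fin n) (Sec A V) →+ (tensorSheaf M.pre (matLie n A).pre).pre.Γ V :=
        AddMonoidHom.mk' (fun x => tmul M.pre (matLie n A).pre m x) (tmul_add M.pre (matLie n A).pre m)
      refine Eq.trans ?_ (congrArg τ (Matrix.matrix_eq_sum_single x).symm)
      simp only [map_sum]
      refine Finset.sum_congr rfl fun i _ => Finset.sum_congr rfl fun j _ => ?_
      refine (congrArg (fun z => tmul M.pre (matLie n A).pre z
        (Matrix.single i j 1 : Matrix (Fin n) (Fin n) (Sec A V))) (matCoef_tmul M i j m x)).trans ?_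
      refine (tmul_smul_left _ _ _ _ _).trans ?_
      refine congrArg (tmul M.pre (matLie n A).pre m) ?_
      refine (Matrix.smul_single (x i j) i j (1 : Sec A V)).trans ?_
      rw [smul_eq_mul, mul_one])
  rw [← AddMonoidHom.id_apply _ x, ← AddMonoidHom.id_apply _ y, ← key x, ← key y]
  simp only [AddMonoidHom.finsetSum_apply, AddMonoidHom.comp_apply, h]

end MatrixForms

/-! ### The identification of forms with matrices of forms. -/

section Triad

variable {K : Type v} [RCLike K] {T : DifferentialTriad K X} {n : ℕ} {U : Opens X}

lemma matCoef_matForm (Θ : Fin n → Fin n → T.Ω.pre.Γ U) (i j : Fin n) :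
    matCoef T.Ω i j U (matForm T Θ) = Θ i j := by
  unfold matForm
  simp only [map_sum]
  refine (Finset.sum_congr rfl fun p _ => Finset.sum_congr rfl fun q _ =>
    matCoef_tmul T.Ω i j (Θ p q) (Matrix.single p q 1)).trans ?_
  rw [Finset.sum_eq_single i, Finset.sum_eq_single j]
  · simp
  · intro q _ hq
    simp [hq]
  · simp
  · intro p _ hp
    simp [hp]
  · simp

/-- Every form thus has a matrix, which supplies the witness required by `HasForm`. -/
lemma matForm_matCoef (x : (tensorSheaf T.Ω.pre (matLie n T.A).pre).pre.Γ U) :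
    matForm T (fun i j => matCoef T.Ω i j U x) = x :=
  matCoef_ext fun i j => matCoef_matForm _ i j

/-- `HasForm` asks only for some matrix representing the form. Injectivity shows that two
connections with the same form share that matrix. -/
lemma matForm_injective :
    Function.Injective (matForm T : (Fin n → Fin n → T.Ω.pre.Γ U) → _) := by
  intro Θ Θ' h
  ext i j
  rw [← matCoef_matForm Θ i j, h, matCoef_matForm]

end Triad

/-! ### Matrix algebra of a change of basis. -/

section ChangeOfBasis

variable {R M E W ι : Type*} [CommRing R] [AddCommGroup M] [Module R M] [AddCommGroup E]
  [Module R E] [AddCommGroup W] [Fintype ι]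

/-- With h' inverse to h, this is h(h⁻¹Θh + h⁻¹δ) = Θh + δ, written out in entries because those of
Θ and δ lie in a module. -/
lemma sum_smul_transform [DecidableEq ι] {h h' : Matrix ι ι R} (hh : h * h' = 1) (Θ δ : ι → ι → M) (i j : ι) :
    ∑ k, h i k • (∑ p, ∑ q, (h' k p * h q j) • Θ p q + ∑ p, h' k p • δ p j) =
      ∑ k, h k j • Θ i k + δ i j := by
  have hh' (k : ι) : ∑ m, h i m * h' m k = if i = k then 1 else 0 := by
    rw [← Matrix.mul_apply, ← Matrix.one_apply, hh]
  simp only [smul_add, Finset.sum_add_distrib, Finset.smul_sum, smul_smul]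
  congr 1
  · rw [Finset.sum_comm, Finset.sum_congr rfl fun k _ => Finset.sum_comm]
    simp only [← mul_assoc, ← Finset.sum_smul, ← Finset.sum_mul, hh']
    simp [ite_mul, ite_smul]
  · rw [Finset.sum_comm]
    simp only [← Finset.sum_smul, hh']
    simp

/-- The expression `∑ e_i ⊗ (dc_i + ∑ θ_ij c_j)` does not depend on the basis. -/
lemma sum_connection_transform (B : E →+ M →+ W) (hB : ∀ (a : R) e m, B (a • e) m = B e (a • m))
    (h : Matrix ι ι R) (d : R →+ M) (hd : ∀ a b, d (a * b) = a • d b + b • d a)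
    (e : ι → E) (c : ι → R) (Θ Θ' : ι → ι → M)
    (hΘ : ∀ i j, ∑ k, h i k • Θ' k j = ∑ k, h k j • Θ i k + d (h i j)) :
    ∑ l, B (∑ i, h i l • e i) (d (c l) + ∑ k, c k • Θ' l k) =
      ∑ i, B (e i) (d (h.mulVec c i) + ∑ j, h.mulVec c j • Θ i j) := by
  -- The column dc + Θc is covariant: d(hc) = h dc + (dh)c, and by `hΘ` the terms (dh)c + Θhc
  -- combine into hΘ'c. Then `hB` moves the entries of h to the other argument of `B`, where they
  -- change the basis.
  have h1 : ∀ i, d (h.mulVec c i) + ∑ j, h.mulVec c j • Θ i j =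
      ∑ l, h i l • (d (c l) + ∑ k, c k • Θ' l k) := by
    intro i
    simp only [Matrix.mulVec, dotProduct, map_sum, hd, smul_add, Finset.sum_add_distrib,
      Finset.smul_sum, Finset.sum_smul]
    rw [add_assoc]
    congr 1
    have h2 : ∑ l, ∑ k, h i l • c k • Θ' l k = ∑ k, c k • ∑ l, h i l • Θ' l k := by
      rw [Finset.sum_comm]
      simp only [Finset.smul_sum, smul_smul, mul_comm]
    have h3 : ∑ j, ∑ k, (h j k * c k) • Θ i j = ∑ k, c k • ∑ j, h j k • Θ i j := by
      rw [Finset.sum_comm]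
      simp only [Finset.smul_sum, smul_smul, mul_comm]
    rw [h2, h3]
    simp only [hΘ, smul_add, Finset.sum_add_distrib]
    rw [add_comm]
  simp only [h1, map_sum, AddMonoidHom.finsetSum_apply, hB]
  exact Finset.sum_comm

end ChangeOfBasis

/-! ### Transformation of the forms (1 ⊗ φbar)(D(s)). -/

section LieType

variable {K : Type v} [RCLike K] {T : DifferentialTriad K X} {G : LieTypeGroup T} {n : ℕ}
  {φ : G.G.obj ⟶ glPre n T.A} {φbar : LiePresheaf.Hom G.L (matLie n T.A)}

/-- `1 ⊗ φbar` intertwines the action of `G` by `ρ` and the adjoint action by means of `φ`. -/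
lemma IsLieType.tensorMap_tensorAct (hφ : IsLieType G φ φbar) {U : Opens X}
    (g : G.G.obj.obj (op U)) (x : (tensorSheaf T.Ω.pre G.L.pre).pre.Γ U) :
    tensorMap T.Ω.pre φbar.pre U (G.ρ.tensorAct T.Ω.pre g x) =
      (Ad n T.A).tensorAct T.Ω.pre (φ.app (op U) g) (tensorMap T.Ω.pre φbar.pre U x) := by
  have hg : gres G.G (le_refl U) g = g := ConcreteCategory.congr_hom (G.G.obj.map_id (op U)) g
  have hgr {V W : Opens X} (h : V ≤ U) (k : W ≤ V) :
      gres G.G k (gres G.G h g) = gres G.G (k.trans h) g :=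
    (ConcreteCategory.congr_hom (G.G.obj.map_comp (homOfLE h).op (homOfLE k).op) g).symm
  -- On pure tensors the claim is `comp_rho`. Both sides have to be read over all `V ≤ U`, with `g`
  -- restricted to `V`.
  have key := tensorSheaf_hom_ext (M := T.Ω.pre) (N := G.L.pre)
    (F := tensorSheaf T.Ω.pre (matLie n T.A).pre) (U := U)
    (f := fun V h => (tensorMap T.Ω.pre φbar.pre V).comp
      (G.ρ.tensorAct T.Ω.pre (gres G.G h g)))
    (g := fun V h => ((Ad n T.A).tensorAct T.Ω.pre (φ.app (op V) (gres G.G h g))).comp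
      (tensorMap T.Ω.pre φbar.pre V))
    (fun V W h k x => by
      simp only [AddMonoidHom.comp_apply]
      rw [res_tensorMap, LieRep.res_tensorAct]
      exact congrArg (fun g => tensorMap T.Ω.pre φbar.pre W (G.ρ.tensorAct T.Ω.pre g _)) (hgr h k))
    (fun V W h k x => by
      simp only [AddMonoidHom.comp_apply]
      rw [LieRep.res_tensorAct, res_tensorMap, ← PrincipalSheaf.app_gres, hgr])
    (fun V h m l => by
      simp only [AddMonoidHom.comp_apply]
      refine (congrArg _ (LieRep.tensorAct_tmul _ _ _ _ _)).trans ?_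
      refine (tensorMap_tmul _ _ _ _).trans ?_
      rw [tensorMap_tmul]
      refine Eq.trans ?_ (LieRep.tensorAct_tmul _ _ _ _ _).symm
      exact congrArg (tmul T.Ω.pre (matLie n T.A).pre m) (hφ.comp_rho V (gres G.G h g) l)) x
  simp only [AddMonoidHom.comp_apply, hg] at key
  exact key

variable {P : PrincipalSheaf.{u, w} G.G} (D : PConnection G P)

/-- The matrix of forms `(1 ⊗ φbar)(D(s))` of a section `s` of `P`. -/
noncomputable def PConnection.formMatrix (φbar : LiePresheaf.Hom G.L (matLie n T.A))
    {U : Opens X} (s : P.Γ U) (i j : Fin n) : T.Ω.pre.Γ U :=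
  matCoef T.Ω i j U (tensorMap T.Ω.pre φbar.pre U (D.app U s))

/-- The two Lie type conditions treat one summand each of D(sg) = ρ(g⁻¹).D(s) + ∂(g): `comp_rho` the
first, `mc_comp` the second. -/
lemma PConnection.tensorMap_act (hφ : IsLieType G φ φbar) {U : Opens X} (s : P.Γ U)
    (g : G.G.obj.obj (op U)) :
    tensorMap T.Ω.pre φbar.pre U (D.app U (P.act s g)) =
      (Ad n T.A).tensorAct T.Ω.pre (φ.app (op U) g)⁻¹
        (tensorMap T.Ω.pre φbar.pre U (D.app U s)) + glMC T (φ.app (op U) g) := by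
  rw [D.app_act, map_add, hφ.tensorMap_tensorAct, hφ.mc_comp, map_inv]

lemma PConnection.res_formMatrix {U V : Opens X} (h : V ≤ U) (s : P.Γ U) (i j : Fin n) :
    T.Ω.pre.res h (D.formMatrix φbar s i j) = D.formMatrix φbar (P.res h s) i j := by
  unfold PConnection.formMatrix
  rw [res_matCoef, res_tensorMap, D.app_res]

/-- In matrices, with h = φ(g), this reads θ' = h⁻¹θh + h⁻¹dh. -/
lemma PConnection.formMatrix_act (hφ : IsLieType G φ φbar) {U : Opens X} (s : P.Γ U)
    (g : G.G.obj.obj (op U)) (i j : Fin n) :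
    D.formMatrix φbar (P.act s g) i j =
      ∑ k, ∑ l, ((φ.app (op U) g : GL (Fin n) (Sec T.A U))⁻¹.1 i k *
        (φ.app (op U) g : GL (Fin n) (Sec T.A U)).1 l j) • D.formMatrix φbar s k l +
      ∑ k, (φ.app (op U) g : GL (Fin n) (Sec T.A U))⁻¹.1 i k •
        T.d U ((φ.app (op U) g : GL (Fin n) (Sec T.A U)).1 k j) := by
  unfold PConnection.formMatrix
  rw [D.tensorMap_act hφ, map_add]
  refine congrArg₂ (· + ·) ((matCoef_tensorAct T.Ω i j _ _).trans ?_) (matCoef_matForm _ i j)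
  -- The adjoint action is that of h⁻¹, so its right-hand factor appears as the inverse of h⁻¹.
  exact Finset.sum_congr rfl fun k _ => Finset.sum_congr rfl fun l _ =>
    congrArg (fun h : GL (Fin n) (Sec T.A U) =>
      ((φ.app (op U) g : GL (Fin n) (Sec T.A U))⁻¹.1 i k * h.1 l j) •
        matCoef T.Ω k l U (tensorMap T.Ω.pre φbar.pre U (D.app U s)))
      (inv_inv (φ.app (op U) g : GL (Fin n) (Sec T.A U)))

/-- `h θ' = θ h + dh` for the matrices of forms `θ` of `s` and `θ'` of `s g`, where `h = φ(g)`. -/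
lemma PConnection.mul_formMatrix_act (hφ : IsLieType G φ φbar) {U : Opens X} (s : P.Γ U)
    (g : G.G.obj.obj (op U)) (i j : Fin n) :
    ∑ k, (φ.app (op U) g : GL (Fin n) (Sec T.A U)).1 i k • D.formMatrix φbar (P.act s g) k j =
      ∑ k, (φ.app (op U) g : GL (Fin n) (Sec T.A U)).1 k j • D.formMatrix φbar s i k +
        T.d U ((φ.app (op U) g : GL (Fin n) (Sec T.A U)).1 i j) := by
  simp only [D.formMatrix_act hφ]
  let h : GL (Fin n) (Sec T.A U) := φ.app (op U) g
  exact sum_smul_transform (h := h.1) (h' := h⁻¹.1) (by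
    rw [← Units.val_mul, mul_inv_cancel, Units.val_one]) (D.formMatrix φbar s)
    (fun i j => T.d U (h.1 i j)) i j

end LieType

/-! ### Local bases and the cocycle of the associated sheaf. -/

section Frames

variable {A : X.Sheaf CommRingCat.{u}} {n : ℕ} {G : X.Sheaf GrpCat.{u}}
  (P : PrincipalSheaf.{u, w} G) (φ : G.obj ⟶ glPre n A)

namespace PrincipalSheaf

lemma res_frameIso {U V : Opens X} (h : V ≤ U) (s : P.Γ U) (a : Fin n → Sec A U) :
    (P.assoc φ).pre.res h (P.frameIso φ s a) = P.frameIso φ (P.res h s) (vres A h a) :=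
  P.cls_res φ h s a

lemma res_frame {U V : Opens X} (h : V ≤ U) (s : P.Γ U) (j : Fin n) :
    (P.assoc φ).pre.res h (P.frame φ s j) = P.frame φ (P.res h s) j := by
  refine (P.res_frameIso φ h s _).trans (congrArg (P.frameIso φ (P.res h s)) ?_)
  ext i
  change rres A h (Pi.single (M := fun _ => Sec A U) j 1 i) =
    Pi.single (M := fun _ => Sec A V) j 1 i
  by_cases hij : i = j
  · subst hij; simp only [Pi.single_eq_same, map_one]
  · simp only [Pi.single_eq_of_ne hij, map_zero]

lemma sum_smul_frame {U : Opens X} (s : P.Γ U) (a : Fin n → Sec A U) :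
    ∑ i, a i • P.frame φ s i = P.frameIso φ s a := by
  have h : ∑ i, a i • (Pi.single i 1 : Fin n → Sec A U) = a := by
    ext j
    simp [Finset.sum_apply, Pi.single_apply]
  refine Eq.trans ?_ (congrArg (P.frameIso φ s) h)
  rw [map_sum]
  exact Finset.sum_congr rfl fun i _ => (map_smul (P.frameIso φ s) (a i) _).symm

/-- As [sg, ε_j] = [s, φ(g)ε_j], the new basis vector has the j-th column of φ(g) as coordinates. -/
lemma frame_act {U : Opens X} (s : P.Γ U) (g : G.obj.obj (op U)) (j : Fin n) :
    P.frame φ (P.act s g) j =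
      ∑ i, (φ.app (op U) g : GL (Fin n) (Sec A U)).1 i j • P.frame φ s i := by
  rw [sum_smul_frame]
  refine (P.cls_act φ s g _).trans (congrArg (P.cls φ s) ?_)
  exact Matrix.mulVec_single_one _ _

lemma isVectorSheaf_assoc : IsVectorSheaf n (P.assoc φ) := by
  intro x
  have hx : x ∈ ⨆ α, P.cover α := by rw [P.iSup_cover]; trivial
  obtain ⟨α, hα⟩ := Opens.mem_iSup.1 hx
  refine ⟨P.cover α, hα, fun V h => P.frameIso φ (P.res h (P.natSec α)), fun V W h k a => ?_⟩
  refine (P.res_frameIso φ k _ a).trans ?_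
  exact congrArg (fun s => P.frameIso φ s (vres A k a)) (P.res_res h k _)

lemma frameIso_symm_frameIso (α β : P.ι) (a : Fin n → Sec A (P.cover α ⊓ P.cover β)) :
    (P.frameIso φ (P.res inf_le_left (P.natSec α))).symm
        (P.frameIso φ (P.res inf_le_right (P.natSec β)) a) =
      glVec (φ.app (op (P.cover α ⊓ P.cover β)) (P.cocycle α β)) a := by
  rw [LinearEquiv.symm_apply_eq, P.natSec_cocycle]
  exact P.cls_act φ _ _ a

end PrincipalSheaf

end Frames

/-! ### The connection in the basis given by a section of `P`. -/

section LocalConnection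

variable {K : Type v} [RCLike K] {T : DifferentialTriad K X} {G : LieTypeGroup T} {n : ℕ}
  {φ : G.G.obj ⟶ glPre n T.A} {φbar : LiePresheaf.Hom G.L (matLie n T.A)}
  {P : PrincipalSheaf.{u, w} G.G} (D : PConnection G P)

/-- Leibniz for 1 · 1 gives d1 = d1 + d1. This makes the connection linear over `K` and removes the
differential of the coordinates of a basis vector. -/
lemma DifferentialTriad.d_one (T : DifferentialTriad K X) (U : Opens X) : T.d U 1 = 0 := by
  have := T.d_mul (U := U) 1 1
  rw [mul_one, one_smul] at this
  exact left_eq_add.1 this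

variable (φ φbar) in
/-- The value `∑ e_i ⊗ (dc_i + ∑ θ_ij c_j)` at `∑ c_i e_i` of the connection with the form
`(1 ⊗ φbar)(D(s))` with respect to the basis `e_i` defined by `s`. -/
noncomputable def PConnection.localConn {U : Opens X} (s : P.Γ U) (σ : P.AssocSec φ U) :
    (tensorSheaf (P.assoc φ).pre T.Ω.pre).pre.Γ U :=
  ∑ i, tmul (P.assoc φ).pre T.Ω.pre (P.frame φ s i) (T.d U (P.coord φ s σ i) +
    ∑ j, P.coord φ s σ j • D.formMatrix φbar s i j)

lemma PConnection.res_localConn {U V : Opens X} (h : V ≤ U) (s : P.Γ U) (σ : P.AssocSec φ U) :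
    (tensorSheaf (P.assoc φ).pre T.Ω.pre).pre.res h (D.localConn φ φbar s σ) =
      D.localConn φ φbar (P.res h s) (P.assocRes φ h σ) := by
  unfold PConnection.localConn
  rw [map_sum]
  refine Finset.sum_congr rfl fun i _ => ?_
  rw [res_tmul, P.res_frame, P.coord_res, map_add, ← T.d_res, map_sum]
  refine congrArg (fun z => tmul (P.assoc φ).pre T.Ω.pre (P.frame φ (P.res h s) i) (_ + z)) ?_
  refine Finset.sum_congr rfl fun j _ => ?_
  rw [PMod.res_smul, D.res_formMatrix]
  rfl

lemma PConnection.localConn_act (hφ : IsLieType G φ φbar) {U : Opens X} (s : P.Γ U)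
    (g : G.G.obj.obj (op U)) (σ : P.AssocSec φ U) :
    D.localConn φ φbar (P.act s g) σ = D.localConn φ φbar s σ := by
  unfold PConnection.localConn
  -- The coordinates for s are expressed through those for sg, so that only the latter occur on both
  -- sides, as in `sum_connection_transform`.
  have hc : P.coord φ s σ =
      (φ.app (op U) g : GL (Fin n) (Sec T.A U)).1.mulVec (P.coord φ (P.act s g) σ) := by
    refine Eq.trans ?_ (congrArg (glVec (φ.app (op U) g)) (P.coord_act φ s g σ).symm)
    rw [← glVec_mul, ← map_mul, mul_inv_cancel, map_one, glVec_one]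
  rw [hc]
  simp only [P.frame_act]
  exact sum_connection_transform
    (AddMonoidHom.mk' (fun e => AddMonoidHom.mk' (fun m => tmul (P.assoc φ).pre T.Ω.pre e m)
      fun m m' => tmul_add _ _ e m m') fun e e' => by ext m; exact add_tmul _ _ e e' m)
    (fun a e m => tmul_smul_left (P.assoc φ).pre T.Ω.pre a e m)
    (φ.app (op U) g : GL (Fin n) (Sec T.A U)).1 (T.d U) T.d_mul (P.frame φ s)
    (P.coord φ (P.act s g) σ) (D.formMatrix φbar s) (D.formMatrix φbar (P.act s g))
    (D.mul_formMatrix_act hφ s g)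

/-- Sections of `G` act simply transitively on the sections of `P`, so invariance under s ↦ sg is
independence of s. This is what permits gluing. -/
lemma PConnection.localConn_eq (hφ : IsLieType G φ φbar) {U : Opens X} (s s' : P.Γ U)
    (σ : P.AssocSec φ U) : D.localConn φ φbar s σ = D.localConn φ φbar s' σ := by
  obtain ⟨g, rfl, -⟩ := P.existsUnique_act s s'
  exact (D.localConn_act hφ s g σ).symm

lemma PConnection.localConn_add {U : Opens X} (s : P.Γ U) (σ τ : P.AssocSec φ U) :
    D.localConn φ φbar s (σ + τ) = D.localConn φ φbar s σ + D.localConn φ φbar s τ := by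
  unfold PConnection.localConn
  rw [← Finset.sum_add_distrib]
  refine Finset.sum_congr rfl fun i _ => ?_
  rw [← tmul_add, P.coord_add]
  refine congrArg (tmul _ _ _) ?_
  simp only [Pi.add_apply, map_add, add_smul, Finset.sum_add_distrib]
  exact add_add_add_comm _ _ _ _

lemma PConnection.localConn_smul {U : Opens X} (s : P.Γ U) (a : Sec T.A U)
    (σ : P.AssocSec φ U) :
    D.localConn φ φbar s (a • σ) = a • D.localConn φ φbar s σ +
      tmul (P.assoc φ).pre T.Ω.pre σ (T.d U a) := by
  -- Once σ is expanded in the basis, the second summand of d(a c_i) = a dc_i + c_i da is seen to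
  -- contribute exactly σ ⊗ da.
  have hσ : tmul (P.assoc φ).pre T.Ω.pre σ (T.d U a) =
      ∑ i, tmul (P.assoc φ).pre T.Ω.pre (P.frame φ s i) (P.coord φ s σ i • T.d U a) := by
    have h : ∑ i, P.coord φ s σ i • P.frame φ s i = σ :=
      (P.sum_smul_frame φ s _).trans (P.cls_coord φ s σ)
    let τ : (P.assoc φ).pre.Γ U →+ (tensorSheaf (P.assoc φ).pre T.Ω.pre).pre.Γ U :=
      AddMonoidHom.mk' (fun e => tmul (P.assoc φ).pre T.Ω.pre e (T.d U a))
        fun e e' => add_tmul _ _ e e' _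
    refine (congrArg τ h).symm.trans ((map_sum τ _ _).trans ?_)
    exact Finset.sum_congr rfl fun i _ => tmul_smul_left _ _ _ _ _
  rw [hσ]
  unfold PConnection.localConn
  rw [Finset.smul_sum, ← Finset.sum_add_distrib]
  refine Finset.sum_congr rfl fun i _ => ?_
  rw [smul_tmul, ← tmul_add, P.coord_smul]
  refine congrArg (tmul _ _ _) ?_
  simp only [Pi.smul_apply, smul_eq_mul, T.d_mul, mul_smul, smul_add, Finset.smul_sum]
  exact add_right_comm _ _ _

lemma PConnection.localConn_frame {U : Opens X} (s : P.Γ U) (j : Fin n) :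
    D.localConn φ φbar s (P.frame φ s j) =
      ∑ i, tmul (P.assoc φ).pre T.Ω.pre (P.frame φ s i) (D.formMatrix φbar s i j) := by
  have hc : P.coord φ s (P.frame φ s j) = Pi.single j 1 := P.coord_cls φ s _
  unfold PConnection.localConn
  rw [hc]
  refine Finset.sum_congr rfl fun i _ => congrArg (tmul _ _ _) ?_
  have h1 : T.d U (Pi.single (M := fun _ => Sec T.A U) j 1 i) = 0 := by
    by_cases hij : i = j
    · subst hij; rw [Pi.single_eq_same, T.d_one]
    · rw [Pi.single_eq_of_ne hij, map_zero]
  rw [h1, zero_add, Finset.sum_eq_single j]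
  · rw [Pi.single_eq_same, one_smul]
  · intro k _ hk
    rw [Pi.single_eq_of_ne hk, zero_smul]
  · simp

end LocalConnection

/-! ### Gluing, uniqueness and the law for the local forms. -/

section InducedConnection

variable {K : Type v} [RCLike K] {T : DifferentialTriad K X}
  {G : LieTypeGroup T} {n : ℕ} {φ : G.G.obj ⟶ glPre n T.A}
  {φbar : LiePresheaf.Hom G.L (matLie n T.A)} {P : PrincipalSheaf.{u, w} G.G}
  (D : PConnection G P)

/-- A section of `P` over the intersection of `U` with a member of the covering. -/
noncomputable def PrincipalSheaf.locSec (P : PrincipalSheaf.{u, w} G.G) (U : Opens X) (α : P.ι) :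
    P.Γ (U ⊓ P.cover α) :=
  P.res inf_le_right (P.natSec α)

/-- `P` need not have sections over `U`, so the values over the sets `U ∩ U_α` are glued. The result
is characterised by all sections of `P` over all open `V ≤ U`, not only by the natural ones; every
property of the connection then becomes a check on `localConn`. -/
lemma PConnection.exists_conn (hφ : IsLieType G φ φbar) (U : Opens X) (σ : P.AssocSec φ U) :
    ∃ τ : (tensorSheaf (P.assoc φ).pre T.Ω.pre).pre.Γ U, ∀ (V : Opens X) (h : V ≤ U) (s : P.Γ V),
      (tensorSheaf (P.assoc φ).pre T.Ω.pre).pre.res h τ =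
        D.localConn φ φbar s (P.assocRes φ h σ) := by
  obtain ⟨τ, hτ⟩ := (tensorSheaf (P.assoc φ).pre T.Ω.pre).exists_gluing
    (fun α => U ⊓ P.cover α) (fun α => inf_le_left) (P.le_iSup_inf U)
    (fun α => D.localConn φ φbar (P.locSec U α) (P.assocRes φ inf_le_left σ)) (fun α β => by
      rw [D.res_localConn, D.res_localConn, P.assocRes_assocRes, P.assocRes_assocRes]
      exact D.localConn_eq hφ _ _ _)
  refine ⟨τ, fun V h s => ?_⟩
  refine (tensorSheaf (P.assoc φ).pre T.Ω.pre).eq_of_locally_eq (fun α => V ⊓ P.cover α)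
    (fun α => inf_le_left) (P.le_iSup_inf V) fun α => ?_
  have h1 := congrArg ((tensorSheaf (P.assoc φ).pre T.Ω.pre).pre.res
    (inf_le_inf_right (P.cover α) h)) (hτ α)
  rw [PMod.res_res, D.res_localConn, P.assocRes_assocRes] at h1
  rw [PMod.res_res, D.res_localConn, P.assocRes_assocRes]
  exact h1.trans (D.localConn_eq hφ _ _ _)

/-- Sections of a sheaf of modules agree if their restrictions agree wherever `P` has sections. -/
lemma PrincipalSheaf.ext_of_res (P : PrincipalSheaf.{u, w} G.G) {E : SMod T.A} {U : Opens X}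
    {x y : E.pre.Γ U}
    (h : ∀ (V : Opens X) (h : V ≤ U), P.Γ V → E.pre.res h x = E.pre.res h y) : x = y :=
  E.eq_of_locally_eq (fun α => U ⊓ P.cover α) (fun _ => inf_le_left) (P.le_iSup_inf U)
    fun α => h _ _ (P.locSec U α)

/-- The values of the connection on the associated sheaf induced by `D`. -/
noncomputable def PConnection.inducedApp (hφ : IsLieType G φ φbar) (U : Opens X)
    (σ : P.AssocSec φ U) : (tensorSheaf (P.assoc φ).pre T.Ω.pre).pre.Γ U :=
  (D.exists_conn hφ U σ).choose

lemma PConnection.res_inducedApp (hφ : IsLieType G φ φbar) {U V : Opens X} (h : V ≤ U)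
    (s : P.Γ V) (σ : P.AssocSec φ U) :
    (tensorSheaf (P.assoc φ).pre T.Ω.pre).pre.res h (D.inducedApp hφ U σ) =
      D.localConn φ φbar s (P.assocRes φ h σ) :=
  (D.exists_conn hφ U σ).choose_spec V h s

lemma PConnection.inducedApp_add (hφ : IsLieType G φ φbar) {U : Opens X}
    (σ τ : P.AssocSec φ U) :
    D.inducedApp hφ U (σ + τ) = D.inducedApp hφ U σ + D.inducedApp hφ U τ :=
  P.ext_of_res fun V h s => by
    rw [D.res_inducedApp hφ h s, map_add, D.res_inducedApp hφ h s, D.res_inducedApp hφ h s,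
      P.assocRes_add, D.localConn_add]

lemma PConnection.inducedApp_smul (hφ : IsLieType G φ φbar) {U : Opens X} (a : Sec T.A U)
    (σ : P.AssocSec φ U) :
    D.inducedApp hφ U (a • σ) = a • D.inducedApp hφ U σ +
      tmul (P.assoc φ).pre T.Ω.pre σ (T.d U a) :=
  P.ext_of_res fun V h s => by
    rw [D.res_inducedApp hφ h s, map_add, PMod.res_smul, D.res_inducedApp hφ h s,
      P.assocRes_smul, D.localConn_smul, T.d_res]
    exact congrArg (_ + ·) (res_tmul (P.assoc φ).pre T.Ω.pre h σ (T.d U a)).symm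

/-- The `A`-connection on the associated sheaf induced by a connection on `P`. -/
noncomputable def PConnection.induced (hφ : IsLieType G φ φbar) :
    AConnection T (P.assoc φ) where
  app U := AddMonoidHom.mk' (D.inducedApp hφ U) (D.inducedApp_add hφ)
  app_res {U V} h σ := P.ext_of_res fun W k s => by
    refine (D.res_inducedApp hφ k s (P.assocRes φ h σ)).trans ?_
    rw [PMod.res_res]
    exact (congrArg (D.localConn φ φbar s) (P.assocRes_assocRes φ h k σ)).trans
      (D.res_inducedApp hφ (k.trans h) s σ).symm
  app_smul {U} k σ := by
    -- Linearity over `K` is the Leibniz rule for a constant, whose differential is d(k • 1) = k d1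
    -- = 0.
    refine (D.inducedApp_smul hφ _ σ).trans ?_
    have h0 : tmul (P.assoc φ).pre T.Ω.pre σ (0 : T.Ω.pre.Γ U) = 0 := by
      have := tmul_add (P.assoc φ).pre T.Ω.pre σ (0 : T.Ω.pre.Γ U) 0
      rw [add_zero] at this
      exact left_eq_add.1 this
    rw [Algebra.algebraMap_eq_smul_one, T.d_smul, T.d_one, smul_zero]
    exact (congrArg (_ + ·) h0).trans (add_zero _)
  leibniz a σ := D.inducedApp_smul hφ a σ

lemma PConnection.induced_hasForm (hφ : IsLieType G φ φbar) {U : Opens X} (s : P.Γ U) :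
    (D.induced hφ).HasForm s (tensorMap T.Ω.pre φbar.pre U (D.app U s)) := by
  refine ⟨D.formMatrix φbar s, matForm_matCoef _, fun j => ?_⟩
  have h := D.res_inducedApp hφ le_rfl s (P.frame φ s j)
  rw [PMod.res_self] at h
  refine h.trans ((congrArg (D.localConn φ φbar s) (P.assocRes_self φ _)).trans ?_)
  exact D.localConn_frame s j

/-- A connection on the associated sheaf is determined by its local connection forms. -/
lemma AConnection.eq_of_hasForm {N N' : AConnection T (P.assoc φ)}
    {θ : ∀ α, (tensorSheaf T.Ω.pre (matLie n T.A).pre).pre.Γ (P.cover α)}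
    (hN : ∀ α, N.HasForm (P.natSec α) (θ α)) (hN' : ∀ α, N'.HasForm (P.natSec α) (θ α)) :
    N = N' := by
  -- Both connections have the form θ_α, and its matrix is unique, so they agree on the natural
  -- bases.
  have hframe (α : P.ι) (j : Fin n) :
      N.app _ (P.frame φ (P.natSec α) j) = N'.app _ (P.frame φ (P.natSec α) j) := by
    obtain ⟨Θ, hΘ, h⟩ := hN α
    obtain ⟨Θ', hΘ', h'⟩ := hN' α
    obtain rfl : Θ = Θ' := matForm_injective (hΘ.trans hΘ'.symm)
    rw [h, h']
  have happ : N.app = N'.app := by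
    ext U σ
    refine (tensorSheaf (P.assoc φ).pre T.Ω.pre).eq_of_locally_eq (fun α => U ⊓ P.cover α)
      (fun _ => inf_le_left) (P.le_iSup_inf U) fun α => ?_
    rw [← N.app_res, ← N'.app_res]
    -- Over `U ∩ U_α` the section is a combination of the restricted basis, and the Leibniz rule
    -- computes both connections from their values on that basis.
    have hσ := (P.sum_smul_frame φ (P.locSec U α) _).trans
      (P.cls_coord φ (P.locSec U α) ((P.assoc φ).pre.res inf_le_left σ))
    have h1 (j : Fin n) : N.app _ (P.frame φ (P.locSec U α) j) =
        N'.app _ (P.frame φ (P.locSec U α) j) := by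
      unfold PrincipalSheaf.locSec
      rw [← P.res_frame, N.app_res, N'.app_res, hframe]
    refine (congrArg (N.app _) hσ).symm.trans (Eq.trans ?_ (congrArg (N'.app _) hσ))
    refine (map_sum (N.app _) _ _).trans (Eq.trans ?_ (map_sum (N'.app _) _ _).symm)
    refine Finset.sum_congr rfl fun i _ => ?_
    rw [N.leibniz, N'.leibniz, h1]
  -- The remaining fields are propositions, so equal maps `app` give equal connections.
  cases N; cases N'; cases happ; rfl

/-- This is `tensorMap_act` for s_β = s_α g_αβ over `U_α ∩ U_β`. -/
lemma PConnection.res_inducedForm (hφ : IsLieType G φ φbar) (α β : P.ι) :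
    (tensorSheaf T.Ω.pre (matLie n T.A).pre).pre.res inf_le_right (D.inducedForm φbar β) =
      (Ad n T.A).tensorAct T.Ω.pre (φ.app (op (P.cover α ⊓ P.cover β)) (P.cocycle α β))⁻¹
        ((tensorSheaf T.Ω.pre (matLie n T.A).pre).pre.res inf_le_left (D.inducedForm φbar α)) +
      glMC T (φ.app (op (P.cover α ⊓ P.cover β)) (P.cocycle α β)) := by
  unfold PConnection.inducedForm
  rw [res_tensorMap, res_tensorMap, ← D.app_res, ← D.app_res, P.natSec_cocycle,
    D.tensorMap_act hφ]

end InducedConnection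

end ADG

theorem theorem3 {K : Type v} [RCLike K] {X : TopCat.{u}} (T : ADG.DifferentialTriad K X)
    (G : ADG.LieTypeGroup T) (P : ADG.PrincipalSheaf.{u, w} G.G) {n : ℕ}
    (φ : G.G.obj ⟶ ADG.glPre n T.A) (φbar : ADG.LiePresheaf.Hom G.L (ADG.matLie n T.A))
    (hφ : ADG.IsLieType G φ φbar) (D : ADG.PConnection G P) :
    ADG.IsVectorSheaf n (P.assoc φ) ∧
    (∀ (α β : P.ι) (a : Fin n → ADG.Sec T.A (P.cover α ⊓ P.cover β)),
      (P.frameIso φ (P.res inf_le_left (P.natSec α))).symm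
          (P.frameIso φ (P.res inf_le_right (P.natSec β)) a) =
        ADG.glVec (φ.app (op (P.cover α ⊓ P.cover β)) (P.cocycle α β)) a) ∧
    (∀ α β : P.ι,
      (ADG.tensorSheaf T.Ω.pre (ADG.matLie n T.A).pre).pre.res inf_le_right
          (D.inducedForm φbar β) =
        (ADG.Ad n T.A).tensorAct T.Ω.pre
            (φ.app (op (P.cover α ⊓ P.cover β)) (P.cocycle α β))⁻¹
            ((ADG.tensorSheaf T.Ω.pre (ADG.matLie n T.A).pre).pre.res inf_le_left
              (D.inducedForm φbar α)) +
          ADG.glMC T (φ.app (op (P.cover α ⊓ P.cover β)) (P.cocycle α β))) ∧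
    ∃! N : ADG.AConnection T (P.assoc φ),
      ∀ α : P.ι, N.HasForm (P.natSec α) (D.inducedForm φbar α) := by
  exact ⟨P.isVectorSheaf_assoc φ, P.frameIso_symm_frameIso φ, D.res_inducedForm hφ,
    D.induced hφ, fun α => D.induced_hasForm hφ (P.natSec α), fun N hN =>
      ADG.AConnection.eq_of_hasForm hN fun α => D.induced_hasForm hφ (P.natSec α)⟩
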